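/- Let $d\ge 1$ and let $f:\mathbb R^d\to[0,\infty)$ be continuous, with $f(x)=0$ iff $x=0$ and $f(\lambda x)=\lambda f(x)$ for all $\lambda\ge 0$, $x\in\mathbb R^d$. Put $x\vee_f y:=x$ if $f(x)\ge f(y)$ and $x\vee_f y:=y$ if $f(x)<f(y)$; iterated maxima $x_1\vee_f\cdots\vee_f x_k$ are bracketed from the left, and $\bigvee_{f,\,j\ge1}x_j$ is the limit of the finite maxima. Let $\alpha>0$, let $\kappa$ be a Borel probability measure on $S:=\{f=1\}$, let $(E,\mathcal E,m)$ be a $\sigma$-finite measure space, $\mathcal E_0:=\{A\in\mathcal E: m(A)<\infty\}$, and let $(\Omega,\mathcal A,\mathbb P)$ be a probability space. Let $M$ assign to every $A\in\mathcal E_0$ an $\mathbb R^d$-valued random vector $M(A)$ on $\Omega$ such that (1) $M(A_1),\dots,M(A_k)$ are independent whenever $A_1,\dots,A_k\in\mathcal E_0$ are pairwise disjoint; (2) if $A_1,A_2,\dots\in\mathcal E_0$ are pairwise disjoint and $\bigcup_j A_j\in\mathcal E_0$, then almost surely $M(\bigcup_jA_j)=\bigvee_{f,\,j\ge1}M(A_j)=M(A_{j_0})$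 for some (random) index $j_0$; (3) for every $A\in\mathcal E_0$, $M(A)$ has the law of $m(A)^{1/\alpha}Z\Theta$, where $Z$ and $\Theta$ are independent, $\mathbb P(Z\le x)=e^{-x^{-\alpha}}$ for $x>0$ (and $0$ for $x\le 0$), and $\Theta$ has law $\kappa$. A simple function is $g=\sum_{j=1}^k a_j\mathbf 1_{A_j}$ with $k\ge1$, $a_j\ge0$ and pairwise disjoint $A_j\in\mathcal E_0$; its integral is $I(g):=a_1M(A_1)\vee_f\cdots\vee_f a_kM(A_k)$. Let $L^\alpha_+(m)$ be the set of measurable $g:E\to[0,\infty)$ with $\int_E g^\alpha\,dm<\infty$. For $g\in L^\alpha_+(m)$ the integral $I(g)$ is the limit in probability of $I(h_n)$ for simple functions $h_n$ increasing pointwise to $g$. **Theorem.** For every $g\in L^\alpha_+(m)$ the integral $I(g)$ is well defined: sequences of simple functions increasing pointwise to $g$ exist, and along all of them (and for all representations of the simple functions) the integrals converge in probability to one and the same random vector $I(g)$, unique up to almost sure equality. Moreover, for all $g,g_1,g_2,\ldots\in L^\alpha_+(m)$, as $n\to\infty$, $$I(g_n)\to I(g)\ \text{in probability}\iff\int_E|g_n^\alpha-g^\alpha|\,dm\to0\iff\int_E|g_n-g|^\alpha\,dm\to0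 .$$ In particular $I(g)$ is the limit in probability of $I(g_n)$ for arbitrary, not necessarily simple or monotone, sequences $(g_n)$ in $L^\alpha_+(m)$ satisfying one of the last two conditions. -/

import Mathlib

open MeasureTheory ProbabilityTheory Filter Topology
open scoped ENNReal

noncomputable section

namespace ImplicitExtremal

/-- A loss function on `ℝ^d`: nonnegative, continuous, vanishing exactly at the origin and
`1`-homogeneous. -/
structure IsLossFunction {d : ℕ} (f : EuclideanSpace ℝ (Fin d) → ℝ) : Prop where
  nonneg : ∀ x, 0 ≤ f x
  continuous : Continuous f
  eq_zero_iff : ∀ x, f x = 0 ↔ x = 0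
  homogeneous : ∀ (c : ℝ) (x : EuclideanSpace ℝ (Fin d)), 0 ≤ c → f (c • x) = c * f x

open Classical in
/-- The operation `x ∨_f y`: the argument with the larger loss, the first one in case of a tie. -/
def fMax {V : Type*} (f : V → ℝ) (x y : V) : V :=
  if f y ≤ f x then x else y

/-- The iterated operation `x_0 ∨_f x_1 ∨_f ⋯ ∨_f x_k`, bracketed from the left. -/
def fMaxFin {V : Type*} (f : V → ℝ) : (k : ℕ) → (Fin (k + 1) → V) → V
  | 0, x => x 0
  | k + 1, x => fMax f (fMaxFin f k (fun i => x i.castSucc)) (x (Fin.last (k + 1)))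

/-- `y` is the infinite `∨_f`-maximum of the sequence `x`: the limit of the finite maxima
`x_0 ∨_f ⋯ ∨_f x_n`, and attained at some index. -/
def IsFMaxSeq {V : Type*} [TopologicalSpace V] (f : V → ℝ) (x : ℕ → V) (y : V) : Prop :=
  Tendsto (fun n : ℕ => fMaxFin f n (fun i : Fin (n + 1) => x i)) atTop (𝓝 y) ∧ ∃ j, y = x j

/-- The standard `α`-Fréchet law on `ℝ`, given by its distribution function. -/
def IsStandardFrechet (α : ℝ) (ν : Measure ℝ) : Prop :=
  IsProbabilityMeasure ν ∧
    (∀ x : ℝ, 0 < x → ν (Set.Iic x) = ENNReal.ofReal (Real.exp (-(x ^ (-α))))) ∧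
    (∀ x : ℝ, x ≤ 0 → ν (Set.Iic x) = 0)

/-- `Y` has the `f`-implicit `α`-Fréchet distribution with scale `σ` and angular part `κ`: its law
is that of `σ Z Θ`, where `Z` is standard `α`-Fréchet, `Θ` has law `κ` on `{f = 1}`, and `Z`, `Θ`
are independent. -/
def HasImplicitFrechetLaw {Ω : Type*} [MeasurableSpace Ω] (P : Measure Ω) {d : ℕ}
    (f : EuclideanSpace ℝ (Fin d) → ℝ) (α : ℝ) (κ : Measure {x // f x = 1}) (σ : ℝ)
    (Y : Ω → EuclideanSpace ℝ (Fin d)) : Prop :=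
  ∃ ν : Measure ℝ, IsStandardFrechet α ν ∧
    P.map Y = (ν.prod κ).map
      (fun p : ℝ × {x // f x = 1} => (σ * p.1) • (p.2 : EuclideanSpace ℝ (Fin d)))

/-- The class `ℰ₀` of measurable sets of finite `m`-measure. -/
def finiteSets {E : Type*} [MeasurableSpace E] (m : Measure E) : Set (Set E) :=
  {A | MeasurableSet A ∧ m A < ∞}

/-- `M` is an (independently scattered) `f`-implicit sup-measure with control measure `m`. Only the
values of `M` on `finiteSets m` matter. -/
structure IsImplicitSupMeasure {Ω E : Type*} [MeasurableSpace Ω] [MeasurableSpace E]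
    (P : Measure Ω) (m : Measure E) {d : ℕ} (f : EuclideanSpace ℝ (Fin d) → ℝ)
    (M : Set E → Ω → EuclideanSpace ℝ (Fin d)) : Prop where
  measurable : ∀ A ∈ finiteSets m, Measurable (M A)
  indep : ∀ (k : ℕ) (A : Fin k → Set E), (∀ i, A i ∈ finiteSets m) →
    Pairwise (fun i j => Disjoint (A i) (A j)) → iIndepFun (fun i => M (A i)) P
  iUnion : ∀ A : ℕ → Set E, (∀ j, A j ∈ finiteSets m) →
    Pairwise (fun i j => Disjoint (A i) (A j)) → (⋃ j, A j) ∈ finiteSets m →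
    ∀ᵐ ω ∂P, IsFMaxSeq f (fun j => M (A j) ω) (M (⋃ j, A j) ω)

/-- A simple function on `E` together with a representation `∑_{j ≤ k} a_j 1_{A_j}`, with
coefficients `a_j ≥ 0` and disjoint sets `A_j` of finite measure. -/
structure SimpleRep {E : Type*} [MeasurableSpace E] (m : Measure E) where
  k : ℕ
  coeff : Fin (k + 1) → ℝ
  supp : Fin (k + 1) → Set E
  coeff_nonneg : ∀ j, 0 ≤ coeff j
  supp_mem : ∀ j, supp j ∈ finiteSets m
  disjoint : Pairwise (fun i j => Disjoint (supp i) (supp j))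

/-- The simple function with the given representation. -/
def SimpleRep.toFun {E : Type*} [MeasurableSpace E] {m : Measure E} (r : SimpleRep m)
    (s : E) : ℝ :=
  ∑ j, (r.supp j).indicator (fun _ => r.coeff j) s

/-- The integral `a_0 M(A_0) ∨_f ⋯ ∨_f a_k M(A_k)` of a simple function, formed with the given
representation. -/
def SimpleRep.integral {Ω E : Type*} [MeasurableSpace E] {m : Measure E} {d : ℕ}
    (r : SimpleRep m) (f : EuclideanSpace ℝ (Fin d) → ℝ)
    (M : Set E → Ω → EuclideanSpace ℝ (Fin d)) (ω : Ω) : EuclideanSpace ℝ (Fin d) :=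
  fMaxFin f r.k (fun j => r.coeff j • M (r.supp j) ω)

/-- `g_n ↑ g` for a sequence of simple functions: pointwise increasing with pointwise limit `g`,
everywhere on `E`. -/
def IncreasesTo {E : Type*} [MeasurableSpace E] {m : Measure E} (r : ℕ → SimpleRep m)
    (g : E → ℝ) : Prop :=
  (∀ n s, (r n).toFun s ≤ (r (n + 1)).toFun s) ∧
    ∀ s, Tendsto (fun n => (r n).toFun s) atTop (𝓝 (g s))

/-- The random vector `X` is (a version of) the `f`-implicit extremal integral of `g` with respect
to `M`: some sequence of simple functions increases to `g`, and along every such sequence (with any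
choice of representations) the integrals of the simple functions converge to `X` in probability. -/
def IsExtremalIntegral {Ω E : Type*} [MeasurableSpace Ω] [MeasurableSpace E]
    (P : Measure Ω) (m : Measure E) {d : ℕ} (f : EuclideanSpace ℝ (Fin d) → ℝ)
    (M : Set E → Ω → EuclideanSpace ℝ (Fin d)) (g : E → ℝ)
    (X : Ω → EuclideanSpace ℝ (Fin d)) : Prop :=
  Measurable X ∧ (∃ r : ℕ → SimpleRep m, IncreasesTo r g) ∧
    ∀ r : ℕ → SimpleRep m, IncreasesTo r g →
      TendstoInMeasure P (fun n => (r n).integral f M) atTop X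

open Classical in
/-- The `f`-implicit extremal integral `I(g)` (a version of it; it is unique up to almost sure
equality). -/
def extremalIntegral {Ω E : Type*} [MeasurableSpace Ω] [MeasurableSpace E]
    (P : Measure Ω) (m : Measure E) {d : ℕ} (f : EuclideanSpace ℝ (Fin d) → ℝ)
    (M : Set E → Ω → EuclideanSpace ℝ (Fin d)) (g : E → ℝ) : Ω → EuclideanSpace ℝ (Fin d) :=
  if h : ∃ X, IsExtremalIntegral P m f M g X then h.choose else 0

/-- The class `L^α_+(m)` of measurable functions `g : E → [0, ∞)` with `∫ g^α dm < ∞`. -/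
def LpPlus {E : Type*} [MeasurableSpace E] (α : ℝ) (m : Measure E) : Set (E → ℝ) :=
  {g | Measurable g ∧ (∀ s, 0 ≤ g s) ∧ ∫⁻ s, ENNReal.ofReal (g s ^ α) ∂m < ∞}

end ImplicitExtremal

end

open ImplicitExtremal

/-! By homogeneity the loss `f (M A)` is a real Fréchet variable with distribution function `exp
(-m(A) x ^ (-α))`, and disjoint sets give independent losses. Two simple functions share a finite
refinement into cells `C i`, with values `c i`, `c' i`; their integrals are then almost surely
`∨_f`-maxima of the vectors `c i • M (C i)` and `c' i • M (C i)`.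

The danger is that nearly equal losses select different cells, hence vectors in different
directions. Put `l = min c c'`, `u = max c c'`, `S i = f (M (C i))`, and let `L`, `U` be the total
masses `∑ l ^ α m(C)`, `∑ u ^ α m(C)`. With probability at least `L / U` some `l i * S i` beats
every other `u j * S j` (`le_measureReal_winsBy`); then both integrals are multiples of the same
vector `M (C i)`, and their distance is controlled by the gap between the maxima of `u * S` and `l *
S`. That gap is small in probability when `U - L = ∫ |h ^ α - h' ^ α| dm` is small
(`measureReal_gap_le`). If `U` itself is small, both integrals are small. This gives uniform
continuity in probability on bounded sets (`exists_delta_integral`), hence existence of the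
integral, its independence of the approximating sequence, and one direction of the first
equivalence.

Conversely, `max (f (I g)) (f (I g'))` is Fréchet with scale `∫ max(g, g') ^ α dm`. Convergence in
probability is joint, so it passes to these scales, and `|a - b| = 2 max(a, b) - a - b` recovers the
distance of the integrands. The second equivalence is analytic: each of `|a - b| ^ α` and `|a ^ α -
b ^ α|` is at most `ε b ^ α` plus a constant multiple of the other. -/

/-! ### Real Fréchet variables. -/

/-- `S` is a nonnegative random variable with `P (S ≤ x) = exp (-a x ^ (-α))` for `x > 0`. -/
structure FrechetLaw {Ω : Type*} [MeasurableSpace Ω] (P : Measure Ω) (α a : ℝ) (S : Ω → ℝ) :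
    Prop where
  measurable : Measurable S
  nonneg : ∀ ω, 0 ≤ S ω
  scale_nonneg : 0 ≤ a
  measureReal_le : ∀ x, 0 < x → P.real {ω | S ω ≤ x} = Real.exp (-(a * x ^ (-α)))

namespace FrechetLaw

variable {Ω : Type*} [MeasurableSpace Ω] {P : Measure Ω} [IsProbabilityMeasure P] {α a : ℝ}
  {S : Ω → ℝ}

theorem measureReal_lt (h : FrechetLaw P α a S) {x : ℝ} (hx : 0 < x) :
    P.real {ω | S ω < x} = Real.exp (-(a * x ^ (-α))) := by
  apply le_antisymm
  · rw [← h.measureReal_le x hx]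
    exact measureReal_mono fun ω (hω : S ω < x) => hω.le
  · have hc : ContinuousAt (fun y : ℝ => Real.exp (-(a * y ^ (-α)))) x :=
      ((continuousAt_const.mul (Real.continuousAt_rpow_const _ _ (Or.inl hx.ne'))).neg).rexp
    have ht : Tendsto (fun y : ℝ => Real.exp (-(a * y ^ (-α)))) (𝓝[<] x)
      (𝓝 (Real.exp (-(a * x ^ (-α))))) := hc.tendsto.mono_left nhdsWithin_le_nhds
    refine le_of_tendsto ht ?_
    have h0 : ∀ᶠ y in 𝓝[<] x, 0 < y := nhdsWithin_le_nhds (lt_mem_nhds hx)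
    filter_upwards [h0, self_mem_nhdsWithin] with y hy hyx
    rw [← h.measureReal_le y hy]
    exact measureReal_mono fun ω (hω : S ω ≤ y) => lt_of_le_of_lt hω hyx

theorem const_mul (h : FrechetLaw P α a S) (hα : 0 < α) {c : ℝ} (hc : 0 ≤ c) :
    FrechetLaw P α (c ^ α * a) (fun ω => c * S ω) where
  measurable := h.measurable.const_mul c
  nonneg ω := mul_nonneg hc (h.nonneg ω)
  scale_nonneg := mul_nonneg (Real.rpow_nonneg hc _) h.scale_nonneg
  measureReal_le x hx := by
    rcases hc.eq_or_lt with rfl | hc'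
    · simp [hx.le, Real.zero_rpow hα.ne']
    · have : {ω | c * S ω ≤ x} = {ω | S ω ≤ x / c} := by
        ext ω
        simp [le_div_iff₀' hc']
      rw [this, h.measureReal_le _ (div_pos hx hc'), Real.div_rpow hx.le hc, Real.rpow_neg hc]
      congr 2
      rw [div_inv_eq_mul]
      ring

/-- Integrals against the Fréchet law thereby become integrals against an exponential law of rate
`a`. -/
theorem map_eq (h : FrechetLaw P α a S) (hα : 0 < α) (ha : 0 < a) :
    P.map S = (expMeasure a).map (fun t => t ^ (-α⁻¹)) := by
  have := isProbabilityMeasure_expMeasure ha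
  have hm : Measurable (fun t : ℝ => t ^ (-α⁻¹)) := by fun_prop
  have hpos : ∀ᵐ t ∂expMeasure a, 0 < t := by
    have h0 : cdf (expMeasure a) 0 = 0 := by simp [cdf_expMeasure_eq ha]
    rw [cdf_eq_real, measureReal_eq_zero_iff] at h0
    rw [ae_iff]
    convert h0 using 2
    ext; simp
  have := Measure.isProbabilityMeasure_map (μ := P) h.measurable.aemeasurable
  have := Measure.isProbabilityMeasure_map (μ := expMeasure a) hm.aemeasurable
  have key : ∀ x : ℝ, 0 < x → P.map S (Set.Iic x) =
      (expMeasure a).map (fun t => t ^ (-α⁻¹)) (Set.Iic x) := by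
    intro x hx
    rw [← ENNReal.toReal_eq_toReal_iff' (measure_ne_top _ _) (measure_ne_top _ _)]
    change (P.map S).real _ = Measure.real _ _
    rw [map_measureReal_apply h.measurable measurableSet_Iic,
      map_measureReal_apply hm measurableSet_Iic]
    have e1 : (expMeasure a).real ((fun t : ℝ => t ^ (-α⁻¹)) ⁻¹' Set.Iic x)
        = (expMeasure a).real (Set.Iio (x ^ (-α)))ᶜ := by
      apply measureReal_congr
      filter_upwards [hpos] with t ht
      apply propext
      change t ^ (-α⁻¹) ≤ x ↔ ¬ (t < x ^ (-α))
      rw [not_lt, Real.rpow_neg ht.le, ← Real.inv_rpow ht.le,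
        Real.rpow_inv_le_iff_of_pos (by positivity) hx.le hα, Real.rpow_neg hx.le,
        inv_le_comm₀ ht (by positivity)]
    have e2 : (expMeasure a) {x ^ (-α)} = 0 := by
      have : expMeasure a ≪ volume := withDensity_absolutelyContinuous _ _
      exact this (by simp)
    have e3 : (expMeasure a).real (Set.Iio (x ^ (-α))) = (expMeasure a).real (Set.Iic (x ^ (-α))) :=
      measureReal_congr (Iio_ae_eq_Iic' e2)
    rw [e1, probReal_compl_eq_one_sub measurableSet_Iio, e3, ← cdf_eq_real, cdf_expMeasure_eq ha,
      if_pos (by positivity)]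
    have := h.measureReal_le x hx
    change P.real {ω | S ω ≤ x} = _
    rw [this]; ring
  have zero : (expMeasure a).map (fun t => t ^ (-α⁻¹)) (Set.Iic 0) = 0 := by
    rw [Measure.map_apply hm measurableSet_Iic]
    change (expMeasure a) {t | t ^ (-α⁻¹) ≤ 0} = 0
    rw [← nonpos_iff_eq_zero, ← ae_iff.1 hpos]
    apply measure_mono
    intro t ht ht'
    exact absurd ht (not_le.2 (Real.rpow_pos_of_pos ht' _))
  -- The law is prescribed only at `x > 0`; an atom of `S` at `0` is excluded by letting `x`
  -- decrease to `0` along `1 / (n + 1)`.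
  have zero' : P.map S (Set.Iic 0) = 0 := by
    have hl : ∀ ν : Measure ℝ, IsProbabilityMeasure ν →
        Tendsto (fun n : ℕ => ν (Set.Iic (1 / ((n : ℝ) + 1)))) atTop (𝓝 (ν (Set.Iic 0))) := by
      intro ν hν
      have hI : Set.Iic (0 : ℝ) = ⋂ n : ℕ, Set.Iic (1 / ((n : ℝ) + 1)) := by
        ext y
        simp only [Set.mem_Iic, Set.mem_iInter]
        exact ⟨fun hy n => hy.trans (by positivity), fun hy =>
          ge_of_tendsto' tendsto_one_div_add_atTop_nhds_zero_nat hy⟩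
      rw [hI]
      refine tendsto_measure_iInter_atTop (fun n => measurableSet_Iic.nullMeasurableSet) ?_
        ⟨0, measure_ne_top _ _⟩
      intro i j hij
      exact Set.Iic_subset_Iic.2 (one_div_le_one_div_of_le (by positivity) (by gcongr))
    have h1 := hl (P.map S) inferInstance
    have h2 := hl _ ‹IsProbabilityMeasure ((expMeasure a).map (fun t => t ^ (-α⁻¹)))›
    rw [zero] at h2
    refine tendsto_nhds_unique h1 (h2.congr fun n => (key _ (by positivity)).symm)
  refine Measure.ext_of_Iic _ _ fun x => ?_
  rcases lt_or_ge 0 x with hx | hx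
  · exact key x hx
  · rw [measure_mono_null (Set.Iic_subset_Iic.2 hx) zero,
      measure_mono_null (Set.Iic_subset_Iic.2 hx) zero']

/-- Under `x = t ^ (-α⁻¹)` this is the Laplace transform at `b` of the exponential law: multiplying
its density by `exp (-b t)` gives `a / (a + b)` times the density of rate `a + b`. -/
theorem lintegral_exp (h : FrechetLaw P α a S) (hα : 0 < α) (ha : 0 < a) {b : ℝ} (hb : 0 ≤ b) :
    ∫⁻ x in Set.Ioi 0, ENNReal.ofReal (Real.exp (-(b * x ^ (-α)))) ∂(P.map S)
      = ENNReal.ofReal (a / (a + b)) := by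
  have hm : Measurable (fun t : ℝ => t ^ (-α⁻¹)) := by fun_prop
  rw [h.map_eq hα ha, setLIntegral_map measurableSet_Ioi (by fun_prop) hm]
  have hs : MeasurableSet ((fun t : ℝ => t ^ (-α⁻¹)) ⁻¹' Set.Ioi 0) := hm measurableSet_Ioi
  rw [← lintegral_indicator hs]
  change ∫⁻ t, _ ∂(volume.withDensity (exponentialPDF a)) = _
  rw [lintegral_withDensity_eq_lintegral_mul _ (by unfold exponentialPDF; fun_prop)
    (Measurable.indicator (by fun_prop) hs)]
  have : ENNReal.ofReal (a / (a + b)) =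
      ∫⁻ t, ENNReal.ofReal (a / (a + b)) * exponentialPDF (a + b) t := by
    rw [lintegral_const_mul _ (by unfold exponentialPDF; fun_prop),
      lintegral_exponentialPDF_eq_one (by positivity), mul_one]
  rw [this]
  apply lintegral_congr_ae
  have h0 : ∀ᵐ t : ℝ, t ≠ 0 := by simp [ae_iff]
  filter_upwards [h0] with t ht
  simp only [Pi.mul_apply]
  rcases lt_or_gt_of_ne ht with ht | ht
  · simp [exponentialPDF_of_neg ht]
  · rw [Set.indicator_of_mem (by exact Real.rpow_pos_of_pos ht _), exponentialPDF_of_nonneg ht.le,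
      exponentialPDF_of_nonneg ht.le, ← ENNReal.ofReal_mul (by positivity),
      ← ENNReal.ofReal_mul (by positivity), ← Real.rpow_mul ht.le]
    congr 1
    rw [neg_mul_neg, inv_mul_cancel₀ hα.ne', Real.rpow_one, ← mul_assoc,
      div_mul_cancel₀ _ (by positivity), mul_assoc, ← Real.exp_add]
    congr 2
    ring

/-- For independent `W`, `X`, the probability that `X` exceeds all components of `W`. -/
theorem div_le_measureReal_lt {J : Type*} [Fintype J] {X : Ω → ℝ} {b : ℝ} {W : Ω → J → ℝ}
    (hX : FrechetLaw P α a X) (hα : 0 < α) (hb : 0 ≤ b) (hW : Measurable W)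
    (hind : IndepFun X W P)
    (hcdf : ∀ x, 0 < x → P.real {ω | ∀ j, W ω j < x} = Real.exp (-(b * x ^ (-α)))) :
    a / (a + b) ≤ P.real {ω | ∀ j, W ω j < X ω} := by
  rcases hX.scale_nonneg.eq_or_lt with rfl | ha
  · simp
  have hXW := (indepFun_iff_map_prod_eq_prod_map_map hX.measurable.aemeasurable
    hW.aemeasurable).1 hind
  have hA : MeasurableSet {p : ℝ × (J → ℝ) | ∀ j, p.2 j < p.1} := by
    rw [Set.ofPred_forall]
    exact MeasurableSet.iInter fun j => measurableSet_lt (by fun_prop) (by fun_prop)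
  have := Measure.isProbabilityMeasure_map (μ := P) hW.aemeasurable
  have e : P {ω | ∀ j, W ω j < X ω} = ∫⁻ x, P {ω | ∀ j, W ω j < x} ∂(P.map X) := by
    have := Measure.map_apply (μ := P) (hX.measurable.prodMk hW) hA
    rw [hXW, Measure.prod_apply hA] at this
    rw [show {ω | ∀ j, W ω j < X ω} = (fun ω => (X ω, W ω)) ⁻¹' {p | ∀ j, p.2 j < p.1} from rfl,
      ← this]
    refine lintegral_congr fun x => ?_
    rw [Measure.map_apply hW (measurable_prodMk_left hA)]
    rfl
  have e2 : ENNReal.ofReal (a / (a + b)) ≤ P {ω | ∀ j, W ω j < X ω} := by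
    rw [e, ← hX.lintegral_exp hα ha hb]
    refine le_trans (le_of_eq ?_) (setLIntegral_le_lintegral (Set.Ioi 0) _)
    refine setLIntegral_congr_fun measurableSet_Ioi fun x hx => ?_
    rw [← hcdf x hx, ofReal_measureReal]
  rw [measureReal_def]
  exact (ENNReal.ofReal_le_iff_le_toReal (measure_ne_top _ _)).1 e2

end FrechetLaw

/-! ### Races between independent Fréchet variables. -/

section Race

variable {Ω ι : Type*} [MeasurableSpace Ω] {P : Measure Ω} [IsProbabilityMeasure P] {α : ℝ}
  {a : ι → ℝ} {S : ι → Ω → ℝ}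

theorem measureReal_forall_mul_le (hα : 0 < α) (hS : ∀ i, FrechetLaw P α (a i) (S i))
    (hind : iIndepFun S P) (T : Finset ι) {u : ι → ℝ} (hu : ∀ i, 0 ≤ u i) {x : ℝ} (hx : 0 < x) :
    P.real {ω | ∀ j ∈ T, u j * S j ω ≤ x} =
      Real.exp (-((∑ j ∈ T, u j ^ α * a j) * x ^ (-α))) := by
  have h := hind.measure_inter_preimage_eq_mul T (sets := fun j => {s | u j * s ≤ x})
    (fun j _ => measurableSet_le (by fun_prop) (by fun_prop))
  have e : {ω | ∀ j ∈ T, u j * S j ω ≤ x} = ⋂ j ∈ T, S j ⁻¹' {s | u j * s ≤ x} := by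
    ext ω; simp
  rw [measureReal_def, e, h, ENNReal.toReal_prod, Finset.sum_mul, ← Finset.sum_neg_distrib,
    Real.exp_sum]
  exact Finset.prod_congr rfl fun j _ => ((hS j).const_mul hα (hu j)).measureReal_le x hx

theorem measureReal_forall_mul_lt (hα : 0 < α) (hS : ∀ i, FrechetLaw P α (a i) (S i))
    (hind : iIndepFun S P) (T : Finset ι) {u : ι → ℝ} (hu : ∀ i, 0 ≤ u i) {x : ℝ} (hx : 0 < x) :
    P.real {ω | ∀ j ∈ T, u j * S j ω < x} =
      Real.exp (-((∑ j ∈ T, u j ^ α * a j) * x ^ (-α))) := by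
  have h := hind.measure_inter_preimage_eq_mul T (sets := fun j => {s | u j * s < x})
    (fun j _ => measurableSet_lt (by fun_prop) (by fun_prop))
  have e : {ω | ∀ j ∈ T, u j * S j ω < x} = ⋂ j ∈ T, S j ⁻¹' {s | u j * s < x} := by
    ext ω; simp
  rw [measureReal_def, e, h, ENNReal.toReal_prod, Finset.sum_mul, ← Finset.sum_neg_distrib,
    Real.exp_sum]
  exact Finset.prod_congr rfl fun j _ => ((hS j).const_mul hα (hu j)).measureReal_lt hx

variable [Fintype ι]

/-- The event that the `i`-th term wins by a margin. -/
def winsBy (S : ι → Ω → ℝ) (l u : ι → ℝ) (i : ι) : Set Ω :=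
  {ω | ∀ j, j ≠ i → u j * S j ω < l i * S i ω}

theorem measurableSet_winsBy (hS : ∀ i, Measurable (S i)) (l u : ι → ℝ) (i : ι) :
    MeasurableSet (winsBy S l u i) := by
  unfold winsBy
  simp only [Set.ofPred_forall]
  exact MeasurableSet.iInter fun j => MeasurableSet.iInter fun _ =>
    measurableSet_lt (by fun_prop) (by fun_prop)

/-- The maximum of `u j * S j` over `j ≠ i` is Fréchet and independent of `l i * S i`, so
`div_le_measureReal_lt` applies. Enlarging `l i` to `u i` in the denominator makes it the same for
all `i`, so that the bounds can be summed. -/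
theorem le_measureReal_winsBy (hα : 0 < α) (hS : ∀ i, FrechetLaw P α (a i) (S i))
    (hind : iIndepFun S P) {l u : ι → ℝ} (hl : ∀ i, 0 ≤ l i) (hu : ∀ i, 0 ≤ u i)
    (hlu : ∀ i, l i ≤ u i) (i : ι) :
    l i ^ α * a i / ∑ j, u j ^ α * a j ≤ P.real (winsBy S l u i) := by
  classical
  have hm (j : ι) := (hS j).measurable
  let T : Finset ι := Finset.univ.erase i
  have hnn : ∀ j, 0 ≤ u j ^ α * a j := fun j =>
    mul_nonneg (Real.rpow_nonneg (hu j) _) (hS j).scale_nonneg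
  have hb : 0 ≤ ∑ j ∈ T, u j ^ α * a j := Finset.sum_nonneg fun j _ => hnn j
  have hi : IndepFun (fun ω => l i * S i ω) (fun ω (j : T) => u j * S j ω) P := by
    have := hind.indepFun_finset {i} T (by simp [T]) hm
    exact this.comp (φ := fun v : (({i} : Finset ι) → ℝ) => l i * v ⟨i, by simp⟩)
      (ψ := fun (v : T → ℝ) (j : T) => u j * v j)
      (by fun_prop) (by fun_prop)
  have key := ((hS i).const_mul hα (hl i)).div_le_measureReal_lt hα hb (by fun_prop) hi
    (fun x hx => by
      rw [← measureReal_forall_mul_lt hα hS hind T hu hx]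
      congr 1; ext ω; simp)
  have e : {ω | ∀ j : T, u j * S j ω < l i * S i ω} = winsBy S l u i := by
    ext ω; simp [winsBy, T]
  rw [e] at key
  refine le_trans ?_ key
  have hli : 0 ≤ l i ^ α * a i := mul_nonneg (Real.rpow_nonneg (hl i) _) (hS i).scale_nonneg
  rcases hli.eq_or_lt with h0 | h0
  · rw [← h0]; simp
  · apply div_le_div_of_nonneg_left hli (by positivity)
    rw [← Finset.add_sum_erase _ _ (Finset.mem_univ i)]
    gcongr
    · exact (hS i).scale_nonneg
    · exact hl i
    · exact hlu i

/-- Since `l ≤ u`, two indices cannot both win, so the winning probabilities add up. -/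
theorem measureReal_compl_iUnion_winsBy_le (hα : 0 < α)
    (hS : ∀ i, FrechetLaw P α (a i) (S i)) (hind : iIndepFun S P) {l u : ι → ℝ}
    (hl : ∀ i, 0 ≤ l i) (hu : ∀ i, 0 ≤ u i) (hlu : ∀ i, l i ≤ u i) :
    P.real (⋃ i, winsBy S l u i)ᶜ ≤ 1 - (∑ j, l j ^ α * a j) / ∑ j, u j ^ α * a j := by
  have hms := measurableSet_winsBy (fun i => (hS i).measurable) l u
  have hle : ∀ i ω, l i * S i ω ≤ u i * S i ω := fun i ω =>
    mul_le_mul_of_nonneg_right (hlu i) ((hS i).nonneg ω)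
  have hd : Pairwise (Function.onFun Disjoint (winsBy S l u)) := by
    intro i j hij
    refine Set.disjoint_left.2 fun ω h1 h2 => ?_
    have h3 := h1 j hij.symm
    have h4 := h2 i hij
    linarith [hle i ω, hle j ω]
  rw [probReal_compl_eq_one_sub (MeasurableSet.iUnion hms), measureReal_iUnion_fintype hd hms,
    Finset.sum_div]
  gcongr with i
  exact le_measureReal_winsBy hα hS hind hl hu hlu i

/-- The two maxima lie on either side of `x`. This is a difference of nested events, and `exp (-L y)
- exp (-U y) ≤ (U - L) y` for `0 ≤ L ≤ U` and `y ≥ 0`. -/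
theorem measureReal_le_and_exists_lt (hα : 0 < α)
    (hS : ∀ i, FrechetLaw P α (a i) (S i)) (hind : iIndepFun S P) {l u : ι → ℝ}
    (hl : ∀ i, 0 ≤ l i) (hu : ∀ i, 0 ≤ u i) (hlu : ∀ i, l i ≤ u i) {x : ℝ} (hx : 0 < x) :
    P.real {ω | (∀ j, l j * S j ω ≤ x) ∧ ∃ j, x < u j * S j ω} ≤
      (∑ j, u j ^ α * a j - ∑ j, l j ^ α * a j) * x ^ (-α) := by
  have hm (j : ι) := (hS j).measurable
  have hle : ∀ i ω, l i * S i ω ≤ u i * S i ω := fun i ω =>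
    mul_le_mul_of_nonneg_right (hlu i) ((hS i).nonneg ω)
  have e : {ω | (∀ j, l j * S j ω ≤ x) ∧ ∃ j, x < u j * S j ω} =
      {ω | ∀ j ∈ Finset.univ, l j * S j ω ≤ x} \ {ω | ∀ j ∈ Finset.univ, u j * S j ω ≤ x} := by
    ext ω; simp
  have hsub : {ω | ∀ j ∈ Finset.univ, u j * S j ω ≤ x} ⊆
      {ω | ∀ j ∈ Finset.univ, l j * S j ω ≤ x} := fun ω h j hj => (hle j ω).trans (h j hj)
  have hms : MeasurableSet {ω | ∀ j ∈ Finset.univ, u j * S j ω ≤ x} := by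
    simp only [Set.ofPred_forall]
    exact MeasurableSet.iInter fun j => MeasurableSet.iInter fun _ =>
      measurableSet_le (by fun_prop) (by fun_prop)
  rw [e, measureReal_sdiff hsub hms, measureReal_forall_mul_le hα hS hind _ hl hx,
    measureReal_forall_mul_le hα hS hind _ hu hx]
  set L := ∑ j, l j ^ α * a j
  set U := ∑ j, u j ^ α * a j
  have hL : 0 ≤ L := Finset.sum_nonneg fun j _ =>
    mul_nonneg (Real.rpow_nonneg (hl j) _) (hS j).scale_nonneg
  have hLU : L ≤ U := Finset.sum_le_sum fun j _ => by
    have := (hS j).scale_nonneg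
    have := hl j
    have := hlu j
    gcongr
  set y := x ^ (-α)
  have hy : 0 ≤ y := Real.rpow_nonneg hx.le _
  have h1 : Real.exp (-(U * y)) = Real.exp (-(L * y)) * Real.exp (-((U - L) * y)) := by
    rw [← Real.exp_add]; ring_nf
  have h2 := Real.add_one_le_exp (-((U - L) * y))
  have h3 : Real.exp (-(L * y)) ≤ 1 := Real.exp_le_one_iff.2 (by simpa using mul_nonneg hL hy)
  have h4 : 0 ≤ (U - L) * y := mul_nonneg (by linarith) hy
  nlinarith [Real.exp_pos (-(L * y))]

theorem measureReal_exists_lt_le (hα : 0 < α)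
    (hS : ∀ i, FrechetLaw P α (a i) (S i)) (hind : iIndepFun S P) {u : ι → ℝ}
    (hu : ∀ i, 0 ≤ u i) {x : ℝ} (hx : 0 < x) :
    P.real {ω | ∃ j, x < u j * S j ω} ≤ (∑ j, u j ^ α * a j) * x ^ (-α) := by
  have := measureReal_le_and_exists_lt hα hS hind (l := 0) (fun _ => le_rfl) hu hu hx
  simpa [hx.le, Real.zero_rpow hα.ne'] using this

/-- Uniform closeness of the maxima of `l j * S j` and `u j * S j`. -/
theorem measureReal_gap_le (hα : 0 < α)
    (hS : ∀ i, FrechetLaw P α (a i) (S i)) (hind : iIndepFun S P) {l u : ι → ℝ}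
    (hl : ∀ i, 0 ≤ l i) (hu : ∀ i, 0 ≤ u i) (hlu : ∀ i, l i ≤ u i) {ε : ℝ} (hε : 0 < ε) (N : ℕ) :
    P.real {ω | ∃ i, ∀ j, l j * S j ω + 2 * ε ≤ u i * S i ω} ≤
      (∑ j, u j ^ α * a j) * ((N + 1) * ε) ^ (-α) +
      (∑ j, u j ^ α * a j - ∑ j, l j ^ α * a j) *
        ∑ k ∈ Finset.range (N + 1), ((k + 1) * ε) ^ (-α) := by
  -- A gap of length `2 * ε` between the maxima straddles a point `(k + 1) * ε` of the grid, with
  -- strict inequality on the upper side; `k ≤ N` unless the upper maximum exceeds `(N + 1) * ε`.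
  have hsub : {ω | ∃ i, ∀ j, l j * S j ω + 2 * ε ≤ u i * S i ω} ⊆
      {ω | ∃ j, (N + 1) * ε < u j * S j ω} ∪
      ⋃ k ∈ Finset.range (N + 1),
        {ω | (∀ j, l j * S j ω ≤ (k + 1) * ε) ∧ ∃ j, (k + 1) * ε < u j * S j ω} := by
    rintro ω ⟨i, hi⟩
    by_cases hN : (N + 1) * ε < u i * S i ω
    · exact Or.inl ⟨i, hN⟩
    right
    have hi0 : 0 ≤ l i * S i ω := mul_nonneg (hl i) ((hS i).nonneg ω)
    have hpos : 0 ≤ (u i * S i ω - 2 * ε) / ε := div_nonneg (by linarith [hi i]) hε.le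
    set k := ⌊(u i * S i ω - 2 * ε) / ε⌋₊
    have hk1 : (k : ℝ) * ε ≤ u i * S i ω - 2 * ε := (le_div_iff₀ hε).1 (Nat.floor_le hpos)
    have hk2 : u i * S i ω - 2 * ε < (k + 1) * ε := (div_lt_iff₀ hε).1 (Nat.lt_floor_add_one _)
    simp only [Set.mem_iUnion, Finset.mem_range]
    refine ⟨k, ?_, fun j => by linarith [hi j], i, by linarith⟩
    have : (k : ℝ) * ε < (N + 1) * ε := by linarith
    have := lt_of_mul_lt_mul_right this hε.le
    exact_mod_cast this
  refine (measureReal_mono hsub).trans ((measureReal_union_le _ _).trans ?_)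
  refine add_le_add (measureReal_exists_lt_le hα hS hind hu (by positivity)) ?_
  refine (measureReal_biUnion_finset_le _ _).trans ?_
  rw [Finset.mul_sum]
  exact Finset.sum_le_sum fun k _ =>
    measureReal_le_and_exists_lt hα hS hind hl hu hlu (by positivity)

/-- For scales `l ≤ u` of bounded size whose total masses are close, either all terms are small,
or one index wins by a margin and the maxima are close. -/
theorem exists_delta_race {α : ℝ} (hα : 0 < α) {B ε η : ℝ} (hε : 0 < ε) (hη : 0 < η) :
    ∃ δ > 0, ∀ {Ω ι : Type*} [MeasurableSpace Ω] (P : Measure Ω) [IsProbabilityMeasure P]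
      [Fintype ι] (a : ι → ℝ) (S : ι → Ω → ℝ) (_ : ∀ i, FrechetLaw P α (a i) (S i))
      (_ : iIndepFun S P) (l u : ι → ℝ) (_ : ∀ i, 0 ≤ l i) (_ : ∀ i, l i ≤ u i)
      (_ : ∑ j, u j ^ α * a j ≤ B) (_ : ∑ j, u j ^ α * a j - ∑ j, l j ^ α * a j ≤ δ),
      P.real {ω | (∃ j, ε < u j * S j ω) ∧ ¬ ((∃ i, ω ∈ winsBy S l u i) ∧
        ∀ i, ∃ j, u i * S i ω < l j * S j ω + 2 * ε)} ≤ η := by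
  -- Beyond `(N + 1) * ε` the upper maximum is negligible, uniformly over total masses at most `B`.
  obtain ⟨N, hN⟩ : ∃ N : ℕ, (max B 0) * ((N + 1) * ε) ^ (-α) ≤ η / 3 := by
    have h1 : Tendsto (fun N : ℕ => ((N : ℝ) + 1) * ε) atTop atTop :=
      (tendsto_atTop_add_const_right _ _ tendsto_natCast_atTop_atTop).atTop_mul_const hε
    have h2 := ((tendsto_rpow_neg_atTop hα).comp h1).const_mul (max B 0)
    rw [mul_zero] at h2
    exact (h2.eventually (ge_mem_nhds (by positivity : (0 : ℝ) < η / 3))).exists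
  set K := ∑ k ∈ Finset.range (N + 1), (((k : ℝ) + 1) * ε) ^ (-α)
  have hK : 0 ≤ K := Finset.sum_nonneg fun k _ => by positivity
  -- Threshold for the total mass `U`: if `U ≤ V`, some term exceeds `ε` with probability at most `V
  -- * ε ^ (-α) = η`; otherwise `U` is bounded below and `1 - L / U` is controlled by `δ / V`.
  set V := η * ε ^ α
  have hV : 0 < V := by positivity
  refine ⟨min (η / 3 * V) (η / 3 / (K + 1)), by positivity, ?_⟩
  intro Ω ι _ P _ _ a S hS hind l u hl hlu hB hδ
  have hu : ∀ i, 0 ≤ u i := fun i => (hl i).trans (hlu i)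
  set U := ∑ j, u j ^ α * a j
  set L := ∑ j, l j ^ α * a j
  rcases le_total U V with hUV | hUV
  · refine (measureReal_mono fun ω h => h.1).trans
      ((measureReal_exists_lt_le hα hS hind hu hε).trans ?_)
    calc U * ε ^ (-α) ≤ V * ε ^ (-α) := by gcongr
      _ = η := by simp only [V]; rw [mul_assoc, ← Real.rpow_add hε]; simp
  · have hU : 0 < U := hV.trans_le hUV
    have hsub : {ω | (∃ j, ε < u j * S j ω) ∧ ¬ ((∃ i, ω ∈ winsBy S l u i) ∧
        ∀ i, ∃ j, u i * S i ω < l j * S j ω + 2 * ε)} ⊆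
        (⋃ i, winsBy S l u i)ᶜ ∪ {ω | ∃ i, ∀ j, l j * S j ω + 2 * ε ≤ u i * S i ω} := by
      rintro ω ⟨_, h⟩
      by_cases hw : ∃ i, ω ∈ winsBy S l u i
      · right
        by_contra hc
        refine h ⟨hw, fun i => ?_⟩
        by_contra hj
        push Not at hj
        exact hc ⟨i, hj⟩
      · left; simpa using hw
    refine (measureReal_mono hsub).trans ((measureReal_union_le _ _).trans ?_)
    have h1 := measureReal_compl_iUnion_winsBy_le hα hS hind hl hu hlu
    have h2 := measureReal_gap_le hα hS hind hl hu hlu hε N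
    change _ ≤ 1 - L / U at h1
    change _ ≤ U * _ + (U - L) * K at h2
    have h3 : 1 - L / U ≤ η / 3 := by
      rw [one_sub_div hU.ne', div_le_iff₀ hU]
      calc U - L ≤ η / 3 * V := hδ.trans (min_le_left _ _)
        _ ≤ η / 3 * U := by gcongr
    have h4 : U * ((N + 1) * ε) ^ (-α) ≤ η / 3 := by
      refine le_trans ?_ hN
      gcongr
      exact hB.trans (le_max_left _ _)
    have h5 : (U - L) * K ≤ η / 3 := by
      calc (U - L) * K ≤ η / 3 / (K + 1) * K := by
            gcongr; exact hδ.trans (min_le_right _ _)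
        _ ≤ η / 3 / (K + 1) * (K + 1) := by gcongr; linarith
        _ = η / 3 := by field_simp
    linarith

end Race

namespace ImplicitExtremal

/-! ### Finite and infinite `∨_f`-maxima. -/

section Maxima

variable {V : Type*} {f : V → ℝ}

theorem fMaxFin_spec (f : V → ℝ) (k : ℕ) (x : Fin (k + 1) → V) :
    (∃ i, fMaxFin f k x = x i) ∧ ∀ i, f (x i) ≤ f (fMaxFin f k x) := by
  induction k with
  | zero => exact ⟨⟨0, rfl⟩, fun i => by rw [Fin.fin_one_eq_zero i]; rfl⟩
  | succ k ih =>
    obtain ⟨⟨i, hi⟩, hle⟩ := ih (fun i => x i.castSucc)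
    simp only [fMaxFin, fMax]
    split_ifs with h
    · refine ⟨⟨i.castSucc, hi⟩, fun j => ?_⟩
      induction j using Fin.lastCases with
      | last => exact h
      | cast j => exact hle j
    · refine ⟨⟨_, rfl⟩, fun j => ?_⟩
      induction j using Fin.lastCases with
      | last => exact le_rfl
      | cast j => exact (hle j).trans (not_le.1 h).le

theorem IsFMaxSeq.le [TopologicalSpace V] (hf : Continuous f) {x : ℕ → V} {y : V}
    (h : IsFMaxSeq f x y) (j : ℕ) : f (x j) ≤ f y := by
  refine ge_of_tendsto ((hf.tendsto y).comp h.1) ?_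
  filter_upwards [eventually_ge_atTop j] with n hn
  exact (fMaxFin_spec f n (fun i : Fin (n + 1) => x i)).2 ⟨j, by omega⟩

/-- `y` is zero or one of the `x i`, and maximizes the loss. -/
def IsMaxOf [Zero V] {ι : Type*} (f : V → ℝ) (x : ι → V) (y : V) : Prop :=
  (y = 0 ∨ ∃ i, y = x i) ∧ ∀ i, f (x i) ≤ f y

theorem measurable_fMaxFin [MeasurableSpace V] {Ω : Type*} [MeasurableSpace Ω]
    (hf : Measurable f) (k : ℕ) (x : Fin (k + 1) → Ω → V) (hx : ∀ i, Measurable (x i)) :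
    Measurable (fun ω => fMaxFin f k (fun i => x i ω)) := by
  induction k with
  | zero => exact hx 0
  | succ k ih =>
    have h1 := ih (fun i => x i.castSucc) (fun i => hx _)
    exact Measurable.ite (measurableSet_le (hf.comp (hx _)) (hf.comp h1)) h1 (hx _)

end Maxima

/-! ### Common refinements of simple functions. -/

section Refinement

variable {E : Type*} [MeasurableSpace E] {m : Measure E}

theorem SimpleRep.toFun_of_mem (r : SimpleRep m) {j : Fin (r.k + 1)} {s : E} (hs : s ∈ r.supp j) :
    r.toFun s = r.coeff j := by
  unfold SimpleRep.toFun
  rw [Finset.sum_eq_single j]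
  · simp [hs]
  · intro i _ hij
    exact Set.indicator_of_notMem (fun h => Set.disjoint_left.1 (r.disjoint hij) h hs) _
  · simp

theorem SimpleRep.toFun_of_notMem (r : SimpleRep m) {s : E} (hs : ∀ j, s ∉ r.supp j) :
    r.toFun s = 0 :=
  Finset.sum_eq_zero fun j _ => Set.indicator_of_notMem (hs j) _

theorem SimpleRep.toFun_nonneg (r : SimpleRep m) (s : E) : 0 ≤ r.toFun s :=
  Finset.sum_nonneg fun j _ => Set.indicator_nonneg (fun _ _ => r.coeff_nonneg j) _

theorem SimpleRep.measurable_toFun (r : SimpleRep m) : Measurable r.toFun :=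
  Finset.measurable_fun_sum _ fun j _ => measurable_const.indicator (r.supp_mem j).1

/-- The disjoint sets `C` refine the supports of `r`, which has the value `c l` on `C l`. -/
structure IsRefinement {ι : Type*} (r : SimpleRep m) (C : ι → Set E) (c : ι → ℝ) : Prop where
  mem : ∀ l, C l ∈ finiteSets m
  disjoint : Pairwise (fun i j => Disjoint (C i) (C j))
  nonneg : ∀ l, 0 ≤ c l
  eq_on : ∀ l, ∀ s ∈ C l, r.toFun s = c l
  subset_or_disjoint : ∀ l j, C l ⊆ r.supp j ∨ C l ∩ r.supp j = ∅
  cover : ∀ j, r.supp j ⊆ ⋃ l, C l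

/-- The atoms of a family of sets. -/
def atoms {J : Type*} (B : J → Set E) (T : Finset J) : Set E :=
  {s | (∃ j, s ∈ B j) ∧ ∀ j, s ∈ B j ↔ j ∈ T}

/-- Membership in every `B j` is constant on an atom, hence so is `r`. The atoms omit the complement
of `⋃ j, B j`, which keeps their measure finite. -/
theorem exists_isRefinement_atoms {J : Type*} [Fintype J] {B : J → Set E}
    (hB : ∀ j, B j ∈ finiteSets m) (r : SimpleRep m) (φ : Fin (r.k + 1) → J)
    (hφ : ∀ j, r.supp j = B (φ j)) : ∃ c, IsRefinement r (atoms B) c := by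
  classical
  -- The value is read off at an arbitrary point of the atom; on an empty atom the value `0` is a
  -- harmless default.
  refine ⟨fun T => if h : (atoms B T).Nonempty then r.toFun h.some else 0, ?_, ?_, ?_, ?_, ?_, ?_⟩
  · intro T
    have h1 : MeasurableSet (atoms B T) := by
      unfold atoms
      rw [Set.ofPred_and, Set.ofPred_exists, Set.ofPred_forall]
      refine (MeasurableSet.iUnion fun j => (hB j).1).inter (MeasurableSet.iInter fun j => ?_)
      by_cases hj : j ∈ T
      · simpa [hj] using (hB j).1
      · convert (hB j).1.compl using 1
        ext; simp [hj]
    refine ⟨h1, lt_of_le_of_lt (measure_mono (t := ⋃ j, B j) fun s hs => ?_) ?_⟩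
    · simpa using hs.1
    · exact (measure_iUnion_fintype_le _ _).trans_lt (ENNReal.sum_lt_top.2 fun j _ => (hB j).2)
  · intro T T' hTT'
    refine Set.disjoint_left.2 fun s hs hs' => hTT' ?_
    ext j
    rw [← hs.2 j, ← hs'.2 j]
  · intro T
    split_ifs
    · exact r.toFun_nonneg _
    · exact le_rfl
  · intro T s hs
    have hne : (atoms B T).Nonempty := ⟨s, hs⟩
    rw [dif_pos hne]
    have hs' := hne.some_mem
    have key : ∀ j, s ∈ r.supp j ↔ hne.some ∈ r.supp j := fun j => by
      rw [hφ, hs.2, hs'.2]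
    unfold SimpleRep.toFun
    simp only [Set.indicator_apply, key]
  · intro T j
    by_cases hj : φ j ∈ T
    · left; intro s hs; rw [hφ]; exact (hs.2 _).2 hj
    · right
      refine Set.eq_empty_of_forall_notMem fun s hs => hj ?_
      rw [hφ] at hs
      exact (hs.1.2 _).1 hs.2
  · intro j s hs
    rw [hφ] at hs
    exact Set.mem_iUnion.2 ⟨Finset.univ.filter fun i => s ∈ B i, ⟨_, hs⟩, by simp⟩

theorem exists_common_refinement (r r' : SimpleRep m) :
    ∃ (ι : Type) (_ : Fintype ι) (C : ι → Set E) (c c' : ι → ℝ),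
      IsRefinement r C c ∧ IsRefinement r' C c' := by
  let B : Fin (r.k + 1) ⊕ Fin (r'.k + 1) → Set E := Sum.elim r.supp r'.supp
  have hB : ∀ j, B j ∈ finiteSets m := by
    rintro (j | j)
    · exact r.supp_mem j
    · exact r'.supp_mem j
  obtain ⟨c, hc⟩ := exists_isRefinement_atoms hB r Sum.inl fun _ => rfl
  obtain ⟨c', hc'⟩ := exists_isRefinement_atoms hB r' Sum.inr fun _ => rfl
  exact ⟨_, inferInstance, atoms B, c, c', hc, hc'⟩

theorem IsRefinement.toFun_of_notMem {ι : Type*} {r : SimpleRep m} {C : ι → Set E} {c : ι → ℝ}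
    (h : IsRefinement r C c) {s : E} (hs : s ∉ ⋃ l, C l) : r.toFun s = 0 :=
  r.toFun_of_notMem fun j hj => hs (h.cover j hj)

theorem IsRefinement.lintegral_eq {ι : Type*} [Fintype ι] {r r' : SimpleRep m} {C : ι → Set E}
    {c c' : ι → ℝ} (h : IsRefinement r C c) (h' : IsRefinement r' C c') {F : ℝ → ℝ → ℝ}
    (hF : ∀ x y, 0 ≤ F x y) (hF0 : F 0 0 = 0) :
    ∫⁻ s, ENNReal.ofReal (F (r.toFun s) (r'.toFun s)) ∂m =
      ENNReal.ofReal (∑ l, F (c l) (c' l) * (m (C l)).toReal) := by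
  have hm : MeasurableSet (⋃ l, C l) := MeasurableSet.iUnion fun l => (h.mem l).1
  rw [← setLIntegral_eq_of_support_subset (s := ⋃ l, C l), lintegral_iUnion (fun l => (h.mem l).1)
    h.disjoint, tsum_fintype, ENNReal.ofReal_sum_of_nonneg
    fun l _ => mul_nonneg (hF _ _) ENNReal.toReal_nonneg]
  · refine Finset.sum_congr rfl fun l _ => ?_
    rw [setLIntegral_congr_fun (g := fun _ => ENNReal.ofReal (F (c l) (c' l))) (h.mem l).1
      fun s hs => by simp only [h.eq_on l s hs, h'.eq_on l s hs], setLIntegral_const,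
      ENNReal.ofReal_mul (hF _ _), ENNReal.ofReal_toReal (h.mem l).2.ne]
  · intro s hs
    by_contra hc
    exact hs (by simp [h.toFun_of_notMem hc, h'.toFun_of_notMem hc, hF0])

end Refinement

/-! ### Losses of the sup-measure and integrals on a refinement. -/

theorem IsLossFunction.map_zero {d : ℕ} {f : EuclideanSpace ℝ (Fin d) → ℝ}
    (hf : IsLossFunction f) : f 0 = 0 := (hf.eq_zero_iff 0).2 rfl

/-- The loss dominates the norm. -/
theorem IsLossFunction.exists_norm_le {d : ℕ} {f : EuclideanSpace ℝ (Fin d) → ℝ}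
    (hf : IsLossFunction f) : ∃ C > 0, ∀ x, ‖x‖ ≤ C * f x := by
  have hK : IsCompact (Metric.sphere (0 : EuclideanSpace ℝ (Fin d)) 1) := isCompact_sphere 0 1
  have key : ∃ c > 0, ∀ x ∈ Metric.sphere (0 : EuclideanSpace ℝ (Fin d)) 1, c ≤ f x := by
    -- The sphere is empty when `d = 0`; otherwise compactness provides a positive minimum of `f`.
    rcases (Metric.sphere (0 : EuclideanSpace ℝ (Fin d)) 1).eq_empty_or_nonempty with he | hne
    · exact ⟨1, one_pos, by simp [he]⟩
    · obtain ⟨x, hx, hmin⟩ := hK.exists_isMinOn hne hf.continuous.continuousOn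
      refine ⟨f x, (hf.nonneg x).lt_of_ne fun h => ?_, fun y hy => hmin hy⟩
      rw [eq_comm, hf.eq_zero_iff] at h
      simp [h] at hx
  obtain ⟨c, hc, hmin⟩ := key
  refine ⟨c⁻¹, inv_pos.2 hc, fun x => ?_⟩
  rcases eq_or_ne x 0 with rfl | hx
  · simp [hf.map_zero]
  have hx' : 0 < ‖x‖ := norm_pos_iff.2 hx
  have h := hmin (‖x‖⁻¹ • x) (by simp [norm_smul, hx'.ne'])
  rw [hf.homogeneous _ _ (by positivity), ← div_eq_inv_mul, le_div_iff₀ hx'] at h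
  rw [← div_eq_inv_mul, le_div_iff₀ hc]
  linarith

/-- An implicit sup-measure with implicit Fréchet marginals. -/
structure IsFrechetSupMeasure {Ω E : Type*} [MeasurableSpace Ω] [MeasurableSpace E]
    (P : Measure Ω) (m : Measure E) {d : ℕ} (f : EuclideanSpace ℝ (Fin d) → ℝ) (α : ℝ)
    (κ : Measure {x // f x = 1}) (M : Set E → Ω → EuclideanSpace ℝ (Fin d)) : Prop where
  loss : IsLossFunction f
  pos : 0 < α
  sup : IsImplicitSupMeasure P m f M
  law : ∀ A ∈ finiteSets m, HasImplicitFrechetLaw P f α κ ((m A).toReal ^ (1 / α)) (M A)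

namespace IsFrechetSupMeasure

variable {Ω E : Type*} [MeasurableSpace Ω] [MeasurableSpace E]
    {P : Measure Ω} {m : Measure E}
    {d : ℕ} {f : EuclideanSpace ℝ (Fin d) → ℝ} {α : ℝ} {κ : Measure {x // f x = 1}}
    {M : Set E → Ω → EuclideanSpace ℝ (Fin d)}

theorem measurable_integral (H : IsFrechetSupMeasure P m f α κ M) (r : SimpleRep m) :
    Measurable (r.integral f M) :=
  measurable_fMaxFin H.loss.continuous.measurable r.k _
    fun j => (H.sup.measurable _ (r.supp_mem j)).const_smul (r.coeff j)

theorem iIndepFun_of_fintype (H : IsFrechetSupMeasure P m f α κ M) {ι : Type*} [Fintype ι]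
    {C : ι → Set E} (hC : ∀ i, C i ∈ finiteSets m)
    (hd : Pairwise (fun i j => Disjoint (C i) (C j))) :
    iIndepFun (fun i ω => f (M (C i) ω)) P := by
  let e := Fintype.equivFin ι
  have h := H.sup.indep _ (fun i => C (e.symm i)) (fun i => hC _)
    (fun i j hij => hd (e.symm.injective.ne hij))
  have h2 := (h.precomp e.injective).comp (fun _ => f) (fun _ => H.loss.continuous.measurable)
  simpa [Function.comp_def] using h2

variable [IsProbabilityMeasure κ]

/-- Since `f (Θ) = 1` and `Z > 0` almost surely, homogeneity gives `f (σ Z Θ) = σ Z`, and `σ ^ α` is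
the measure of `A`. -/
theorem frechetLaw (H : IsFrechetSupMeasure P m f α κ M) {A : Set E} (hA : A ∈ finiteSets m) :
    FrechetLaw P α (m A).toReal (fun ω => f (M A ω)) where
  measurable := H.loss.continuous.measurable.comp (H.sup.measurable A hA)
  nonneg ω := H.loss.nonneg _
  scale_nonneg := ENNReal.toReal_nonneg
  measureReal_le x hx := by
    obtain ⟨ν, ⟨hν, hpos, hneg⟩, hmap⟩ := H.law A hA
    set a := (m A).toReal
    have ha : 0 ≤ a := ENNReal.toReal_nonneg
    set σ := a ^ (1 / α)
    have hσ : 0 ≤ σ := Real.rpow_nonneg ha _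
    have hσα : σ ^ α = a := by
      rw [← Real.rpow_mul ha, one_div_mul_cancel H.pos.ne', Real.rpow_one]
    have hmf : MeasurableSet {y | f y ≤ x} := measurableSet_le H.loss.continuous.measurable
      measurable_const
    have hm : Measurable (fun p : ℝ × {x // f x = 1} =>
        (σ * p.1) • (p.2 : EuclideanSpace ℝ (Fin d))) :=
      (measurable_fst.const_mul σ).smul (measurable_subtype_coe.comp measurable_snd)
    have e1 : P.real {ω | f (M A ω) ≤ x} = (P.map (M A)).real {y | f y ≤ x} :=
      (map_measureReal_apply (H.sup.measurable A hA) hmf).symm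
    have hae : ∀ᵐ p ∂(ν.prod κ), 0 < p.1 := by
      apply Measure.quasiMeasurePreserving_fst.ae
      rw [ae_iff, ← hneg 0 le_rfl]
      congr 1; ext; simp
    have e2 : (ν.prod κ).real ((fun p : ℝ × {x // f x = 1} =>
        (σ * p.1) • (p.2 : EuclideanSpace ℝ (Fin d))) ⁻¹' {y | f y ≤ x}) =
        (ν.prod κ).real ({z | σ * z ≤ x} ×ˢ Set.univ) := by
      apply measureReal_congr
      filter_upwards [hae] with p hp
      apply propext
      change f ((σ * p.1) • (p.2 : EuclideanSpace ℝ (Fin d))) ≤ x ↔ σ * p.1 ≤ x ∧ True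
      rw [H.loss.homogeneous _ _ (by positivity), p.2.2, mul_one, and_true]
    rw [e1, hmap, map_measureReal_apply hm hmf, e2, measureReal_prod_prod, probReal_univ, mul_one]
    rcases hσ.eq_or_lt with h0 | h0
    · have ha0 : a = 0 := by rw [← hσα, ← h0, Real.zero_rpow H.pos.ne']
      simp [← h0, ha0, hx.le]
    · have : {z | σ * z ≤ x} = Set.Iic (x / σ) := by
        ext z; simp [le_div_iff₀' h0]
      rw [this, measureReal_def, hpos _ (div_pos hx h0), ENNReal.toReal_ofReal (Real.exp_pos _).le,
        Real.div_rpow hx.le hσ, Real.rpow_neg hσ, hσα, div_inv_eq_mul, mul_comm]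

theorem ae_empty (H : IsFrechetSupMeasure P m f α κ M) : ∀ᵐ ω ∂P, M ∅ ω = 0 := by
  have hA : (∅ : Set E) ∈ finiteSets m := ⟨MeasurableSet.empty, by simp⟩
  obtain ⟨ν, ⟨hν, _, _⟩, hmap⟩ := H.law ∅ hA
  have h0 : (m ∅).toReal ^ (1 / α) = 0 := by
    rw [measure_empty, ENNReal.toReal_zero, Real.zero_rpow (one_div_ne_zero H.pos.ne')]
  simp only [h0, zero_mul, zero_smul, Measure.map_const, measure_univ, one_smul] at hmap
  have : ∀ᵐ y ∂(P.map (M ∅)), y = 0 := by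
    rw [hmap, ae_dirac_iff (by simp)]
  exact ae_of_ae_map (H.sup.measurable ∅ hA).aemeasurable this

/-- The finite family is padded by empty sets to a sequence. The padding contributes the value `0`,
which is why `IsMaxOf` admits `0` as a maximum. -/
theorem ae_isMaxOf_iUnion (H : IsFrechetSupMeasure P m f α κ M) {ι : Type*} [Fintype ι]
    {C : ι → Set E} (hC : ∀ i, C i ∈ finiteSets m)
    (hd : Pairwise (fun i j => Disjoint (C i) (C j))) (hU : (⋃ i, C i) ∈ finiteSets m) :
    ∀ᵐ ω ∂P, IsMaxOf f (fun i => M (C i) ω) (M (⋃ i, C i) ω) := by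
  have := Fintype.toEncodable ι
  let D : ℕ → Set E := fun n => ⋃ b ∈ Encodable.decode₂ ι n, C b
  have hD : ∀ n, D n = ∅ ∨ ∃ i, D n = C i := fun n =>
    Encodable.iUnion_decode₂_cases (f := C) (C := fun s => s = ∅ ∨ ∃ i, s = C i) (Or.inl rfl)
      fun b => Or.inr ⟨b, rfl⟩
  have hDe : ∀ i, D (Encodable.encode i) = C i := fun i => by simp [D]
  have hDU : ⋃ n, D n = ⋃ i, C i := Encodable.iUnion_decode₂ C
  have h := H.sup.iUnion D (fun n => by
    rcases hD n with h | ⟨i, h⟩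
    · rw [h]; exact ⟨MeasurableSet.empty, by simp⟩
    · rw [h]; exact hC i) (Encodable.iUnion_decode₂_disjoint_on hd) (hDU ▸ hU)
  rw [hDU] at h
  filter_upwards [h, H.ae_empty] with ω hω h0
  refine ⟨?_, fun i => ?_⟩
  · obtain ⟨n, hn⟩ := hω.2
    rcases hD n with h | ⟨i, h⟩
    · left; simp only [hn, h, h0]
    · right; exact ⟨i, by simp only [hn, h]⟩
  · have := IsFMaxSeq.le H.loss.continuous hω (Encodable.encode i)
    rwa [hDe] at this

/-- Each `M (r.supp j)` is a maximum over the cells inside `r.supp j`, so the integral can be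
evaluated on any refinement. The tie-breaking order is lost, which does no harm: only strict winners
matter later. -/
theorem ae_isMaxOf_integral (H : IsFrechetSupMeasure P m f α κ M) {ι : Type*} [Fintype ι]
    {r : SimpleRep m} {C : ι → Set E} {c : ι → ℝ} (h : IsRefinement r C c) :
    ∀ᵐ ω ∂P, IsMaxOf f (fun l => c l • M (C l) ω) (r.integral f M ω) := by
  have hU : ∀ j, ⋃ l, C l ∩ r.supp j = r.supp j := fun j => by
    rw [← Set.iUnion_inter]
    exact Set.inter_eq_right.2 (h.cover j)
  have hj : ∀ j, ∀ᵐ ω ∂P, IsMaxOf f (fun l => M (C l ∩ r.supp j) ω) (M (r.supp j) ω) := by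
    intro j
    have := H.ae_isMaxOf_iUnion (C := fun l => C l ∩ r.supp j)
      (fun l => ⟨(h.mem l).1.inter (r.supp_mem j).1,
        (measure_mono Set.inter_subset_left).trans_lt (h.mem l).2⟩)
      (fun i k hik => (h.disjoint hik).mono Set.inter_subset_left Set.inter_subset_left)
      (by rw [hU]; exact r.supp_mem j)
    rwa [hU] at this
  filter_upwards [ae_all_iff.2 hj, H.ae_empty] with ω hω h0
  obtain ⟨⟨j, hj⟩, hle⟩ := fMaxFin_spec f r.k (fun j => r.coeff j • M (r.supp j) ω)
  refine ⟨?_, fun l => ?_⟩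
  · change fMaxFin f r.k _ = 0 ∨ ∃ i, fMaxFin f r.k _ = _
    rw [hj]
    rcases (hω j).1 with h1 | ⟨l, hl⟩
    · left; rw [h1, smul_zero]
    · simp only [hl]
      rcases (C l ∩ r.supp j).eq_empty_or_nonempty with he | ⟨s, hs⟩
      · left; rw [he, h0, smul_zero]
      · right
        refine ⟨l, ?_⟩
        rcases h.subset_or_disjoint l j with h2 | h2
        · rw [Set.inter_eq_left.2 h2, ← r.toFun_of_mem hs.2, h.eq_on l s hs.1]
        · exact absurd hs (by simp [h2])
  · change f (c l • M (C l) ω) ≤ _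
    rcases (C l).eq_empty_or_nonempty with he | ⟨s, hs⟩
    · rw [he, h0, smul_zero, H.loss.map_zero]
      exact H.loss.nonneg _
    -- A nonempty cell lies inside some support, or else it carries the value `0`.
    · by_cases hc : ∃ j, s ∈ r.supp j
      · obtain ⟨j, hsj⟩ := hc
        have hsub : C l ∩ r.supp j = C l := by
          rcases h.subset_or_disjoint l j with h2 | h2
          · exact Set.inter_eq_left.2 h2
          · exact absurd (h2 ▸ (⟨hs, hsj⟩ : s ∈ C l ∩ r.supp j)) (Set.notMem_empty s)
        have h3 := (hω j).2 l
        simp only [hsub] at h3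
        refine le_trans ?_ (hle j)
        rw [← h.eq_on l s hs, r.toFun_of_mem hsj, H.loss.homogeneous _ _ (r.coeff_nonneg j),
          H.loss.homogeneous _ _ (r.coeff_nonneg j)]
        exact mul_le_mul_of_nonneg_left h3 (r.coeff_nonneg j)
      · push Not at hc
        rw [← h.eq_on l s hs, r.toFun_of_notMem hc, zero_smul, H.loss.map_zero]
        exact H.loss.nonneg _

/-! ### Distribution and continuity of integrals of simple functions. -/

variable [IsProbabilityMeasure P]

/-- The joint distribution function of the losses of two integrals of simple functions. -/
theorem measureReal_integral_le (H : IsFrechetSupMeasure P m f α κ M) (r r' : SimpleRep m)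
    {x : ℝ} (hx : 0 < x) :
    P.real {ω | max (f (r.integral f M ω)) (f (r'.integral f M ω)) ≤ x} =
      Real.exp (-((∫⁻ s, ENNReal.ofReal (max (r.toFun s) (r'.toFun s) ^ α) ∂m).toReal *
        x ^ (-α))) := by
  obtain ⟨ι, _, C, c, c', h, h'⟩ := exists_common_refinement r r'
  have hu : ∀ l, 0 ≤ max (c l) (c' l) := fun l => (h.nonneg l).trans (le_max_left _ _)
  have key := measureReal_forall_mul_le H.pos (fun l => H.frechetLaw (h.mem l))
    (H.iIndepFun_of_fintype h.mem h.disjoint) Finset.univ (u := fun l => max (c l) (c' l)) hu hx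
  have e : ∫⁻ s, ENNReal.ofReal (max (r.toFun s) (r'.toFun s) ^ α) ∂m =
      ENNReal.ofReal (∑ l, max (c l) (c' l) ^ α * (m (C l)).toReal) := by
    -- The absolute value makes `F` nonnegative at all real arguments; it is removed on the
    -- nonnegative values that occur.
    have := h.lintegral_eq h' (F := fun x y => |max x y| ^ α) (fun x y => by positivity)
      (by simp [Real.zero_rpow H.pos.ne'])
    simp only [abs_of_nonneg (hu _), abs_of_nonneg ((r.toFun_nonneg _).trans (le_max_left _ _))]
      at this
    exact this
  rw [e, ENNReal.toReal_ofReal (Finset.sum_nonneg fun l _ => mul_nonneg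
    (Real.rpow_nonneg (hu l) _) ENNReal.toReal_nonneg), ← key]
  have hiff : ∀ {c : ι → ℝ} {y : EuclideanSpace ℝ (Fin d)} {ω : Ω}, (∀ l, 0 ≤ c l) →
      IsMaxOf f (fun l => c l • M (C l) ω) y → (f y ≤ x ↔ ∀ l, c l * f (M (C l) ω) ≤ x) := by
    intro c y ω hc hy
    have e (l) : f (c l • M (C l) ω) = c l * f (M (C l) ω) := H.loss.homogeneous _ _ (hc l)
    constructor
    · intro hyx l
      rw [← e]; exact (hy.2 l).trans hyx
    · intro hl
      rcases hy.1 with h0 | ⟨l, h0⟩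
      · rw [h0, H.loss.map_zero]; exact hx.le
      · rw [h0, e]; exact hl l
  apply measureReal_congr
  filter_upwards [H.ae_isMaxOf_integral h, H.ae_isMaxOf_integral h'] with ω h1 h2
  apply propext
  change max _ _ ≤ x ↔ ∀ l ∈ Finset.univ, max (c l) (c' l) * f (M (C l) ω) ≤ x
  rw [max_le_iff, hiff h.nonneg h1, hiff h'.nonneg h2, ← forall_and]
  simp only [max_mul_of_nonneg _ _ (H.loss.nonneg _), max_le_iff, Finset.mem_univ, true_imp_iff]

/-- Continuity of the integral of simple functions, uniformly on bounded sets. -/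
theorem exists_delta_integral (H : IsFrechetSupMeasure P m f α κ M) {B : ℝ} (hB : 0 ≤ B)
    {ε η : ℝ} (hε : 0 < ε) (hη : 0 < η) :
    ∃ δ > 0, ∀ r r' : SimpleRep m,
      ∫⁻ s, ENNReal.ofReal (r.toFun s ^ α) ∂m ≤ ENNReal.ofReal B →
      ∫⁻ s, ENNReal.ofReal |r.toFun s ^ α - r'.toFun s ^ α| ∂m ≤ ENNReal.ofReal δ →
      P.real {ω | ε ≤ dist (r.integral f M ω) (r'.integral f M ω)} ≤ η := by
  obtain ⟨K, hK, hnorm⟩ := H.loss.exists_norm_le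
  -- The race is run at level `ε' / 2`. Both outcomes below give distance at most `K * ε' = ε / 2 <
  -- ε`.
  set ε' := ε / (2 * K)
  have hε' : 0 < ε' := by positivity
  obtain ⟨δ, hδ, hrace⟩ := exists_delta_race (B := B + 1) H.pos (half_pos hε') hη
  -- The bound `1` keeps the mass of `u` below `B + 1`.
  refine ⟨min δ 1, by positivity, fun r r' hr hrr' => ?_⟩
  obtain ⟨ι, _, C, c, c', h, h'⟩ := exists_common_refinement r r'
  let l : ι → ℝ := fun i => min (c i) (c' i)
  let u : ι → ℝ := fun i => max (c i) (c' i)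
  have hl : ∀ i, 0 ≤ l i := fun i => le_min (h.nonneg i) (h'.nonneg i)
  have hlu : ∀ i, l i ≤ u i := fun i => min_le_max
  have ha : ∀ i, 0 ≤ (m (C i)).toReal := fun i => ENNReal.toReal_nonneg
  have hD : ∑ i, |c i ^ α - c' i ^ α| * (m (C i)).toReal ≤ min δ 1 := by
    have := h.lintegral_eq h' (F := fun x y => |x ^ α - y ^ α|) (fun x y => abs_nonneg _)
      (by simp)
    rw [this] at hrr'
    exact (ENNReal.ofReal_le_ofReal_iff (by positivity)).1 hrr'
  have hB' : ∑ i, c i ^ α * (m (C i)).toReal ≤ B := by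
    have := h.lintegral_eq h' (F := fun x _ => |x| ^ α) (fun x y => by positivity)
      (by simp [Real.zero_rpow H.pos.ne'])
    simp only [abs_of_nonneg (h.nonneg _), abs_of_nonneg (r.toFun_nonneg _)] at this
    rw [this] at hr
    exact (ENNReal.ofReal_le_ofReal_iff hB).1 hr
  have hpt : ∀ i, u i ^ α - l i ^ α = |c i ^ α - c' i ^ α| ∧
      u i ^ α ≤ c i ^ α + |c i ^ α - c' i ^ α| := by
    intro i
    rcases le_total (c i) (c' i) with hcc | hcc
    · have := Real.rpow_le_rpow (h.nonneg i) hcc H.pos.le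
      simp only [u, l, max_eq_right hcc, min_eq_left hcc]
      rw [abs_of_nonpos (by linarith)]
      constructor <;> linarith
    · have := Real.rpow_le_rpow (h'.nonneg i) hcc H.pos.le
      simp only [u, l, max_eq_left hcc, min_eq_right hcc]
      rw [abs_of_nonneg (by linarith)]
      constructor <;> linarith
  have h1 : ∑ i, u i ^ α * (m (C i)).toReal - ∑ i, l i ^ α * (m (C i)).toReal ≤ δ := by
    rw [← Finset.sum_sub_distrib]
    simp only [← sub_mul, (hpt _).1]
    exact hD.trans (min_le_left _ _)
  have h2 : ∑ i, u i ^ α * (m (C i)).toReal ≤ B + 1 := by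
    refine le_trans (Finset.sum_le_sum fun i _ =>
      mul_le_mul_of_nonneg_right (hpt i).2 (ha i)) ?_
    simp only [add_mul, Finset.sum_add_distrib]
    exact add_le_add hB' (hD.trans (min_le_right _ _))
  have key := hrace P _ _ (fun l => H.frechetLaw (h.mem l))
    (H.iIndepFun_of_fintype h.mem h.disjoint) l u hl hlu h2 h1
  refine le_trans (ENNReal.toReal_mono (measure_ne_top _ _) (measure_mono_ae ?_)) key
  filter_upwards [H.ae_isMaxOf_integral h, H.ae_isMaxOf_integral h'] with ω hy hy' hdist
  change ε ≤ dist (r.integral f M ω) (r'.integral f M ω) at hdist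
  set y := r.integral f M ω
  set y' := r'.integral f M ω
  have hfc (l) : f (c l • M (C l) ω) = c l * f (M (C l) ω) := H.loss.homogeneous _ _ (h.nonneg l)
  have hfc' (l) : f (c' l • M (C l) ω) = c' l * f (M (C l) ω) :=
    H.loss.homogeneous _ _ (h'.nonneg l)
  have hlow : ∀ i, l i * f (M (C i) ω) ≤ f y ∧ l i * f (M (C i) ω) ≤ f y' := fun i =>
    ⟨(mul_le_mul_of_nonneg_right (min_le_left _ _) (H.loss.nonneg _)).trans (hfc i ▸ hy.2 i),
     (mul_le_mul_of_nonneg_right (min_le_right _ _) (H.loss.nonneg _)).trans (hfc' i ▸ hy'.2 i)⟩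
  have hup : ∀ i, c i * f (M (C i) ω) ≤ u i * f (M (C i) ω) ∧
      c' i * f (M (C i) ω) ≤ u i * f (M (C i) ω) := fun i =>
    ⟨mul_le_mul_of_nonneg_right (le_max_left _ _) (H.loss.nonneg _),
     mul_le_mul_of_nonneg_right (le_max_right _ _) (H.loss.nonneg _)⟩
  have htop : (f y = 0 ∨ ∃ i, f y ≤ u i * f (M (C i) ω)) ∧
      (f y' = 0 ∨ ∃ i, f y' ≤ u i * f (M (C i) ω)) := by
    constructor
    · rcases hy.1 with h0 | ⟨i, h0⟩
      · left; rw [h0, H.loss.map_zero]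
      · right; exact ⟨i, by rw [h0, hfc]; exact (hup i).1⟩
    · rcases hy'.1 with h0 | ⟨i, h0⟩
      · left; rw [h0, H.loss.map_zero]
      · right; exact ⟨i, by rw [h0, hfc']; exact (hup i).2⟩
  have hεK : ε = 2 * K * ε' := by simp only [ε']; field_simp
  -- If no `u`-term exceeds `ε' / 2`, both losses, and hence both norms, are small.
  constructor
  · by_contra hc
    push Not at hc
    have b1 : f y ≤ ε' / 2 := by
      rcases htop.1 with h0 | ⟨i, h0⟩
      · rw [h0]; positivity
      · exact h0.trans (hc i)
    have b2 : f y' ≤ ε' / 2 := by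
      rcases htop.2 with h0 | ⟨i, h0⟩
      · rw [h0]; positivity
      · exact h0.trans (hc i)
    have : dist y y' ≤ K * f y + K * f y' := by
      rw [dist_eq_norm]
      exact (norm_sub_le _ _).trans (add_le_add (hnorm _) (hnorm _))
    nlinarith
  · rintro ⟨⟨i, hi⟩, hgap⟩
    -- The winner's `l`-term bounds both losses from below and beats every other `u`-term, so both
    -- maxima are attained at `i`. If a maximum is `0`, its `i`-th term has zero loss and is `0`
    -- too.
    have huni : y = c i • M (C i) ω ∧ y' = c' i • M (C i) ω := by
      constructor
      · rcases hy.1 with h0 | ⟨j, h0⟩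
        · have := hy.2 i
          rw [h0, H.loss.map_zero] at this
          exact h0.trans ((H.loss.eq_zero_iff _).1 (this.antisymm (H.loss.nonneg _))).symm
        · by_cases hji : j = i
          · rw [h0, hji]
          · have h3 : _ < _ := hi j hji
            have h4 := (hlow i).1
            rw [h0, hfc] at h4
            linarith [(hup j).1]
      · rcases hy'.1 with h0 | ⟨j, h0⟩
        · have := hy'.2 i
          rw [h0, H.loss.map_zero] at this
          exact h0.trans ((H.loss.eq_zero_iff _).1 (this.antisymm (H.loss.nonneg _))).symm
        · by_cases hji : j = i
          · rw [h0, hji]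
          · have h3 : _ < _ := hi j hji
            have h4 := (hlow i).2
            rw [h0, hfc'] at h4
            linarith [(hup j).2]
    obtain ⟨j, hj⟩ := hgap i
    have h5 : dist y y' ≤ |c i - c' i| * (K * f (M (C i) ω)) := by
      rw [huni.1, huni.2, dist_eq_norm, ← sub_smul, norm_smul, Real.norm_eq_abs]
      exact mul_le_mul_of_nonneg_left (hnorm _) (abs_nonneg _)
    -- The left side is `|f y - f y'|`, and both losses lie between `l j * f (M (C j) ω)` and `u i *
    -- f (M (C i) ω)`.
    have h6 : |c i - c' i| * f (M (C i) ω) ≤ u i * f (M (C i) ω) - l j * f (M (C j) ω) := by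
      have e1 : f y = c i * f (M (C i) ω) := by rw [huni.1, hfc]
      have e2 : f y' = c' i * f (M (C i) ω) := by rw [huni.2, hfc']
      have e3 := (hlow j).1
      have e4 := (hlow j).2
      have e5 := hup i
      rw [← abs_of_nonneg (H.loss.nonneg (M (C i) ω)), ← abs_mul, sub_mul,
        abs_of_nonneg (H.loss.nonneg (M (C i) ω)), abs_sub_le_iff]
      constructor <;> linarith
    have h7 : dist y y' < K * ε' := by
      calc dist y y' ≤ K * (|c i - c' i| * f (M (C i) ω)) := by linarith
        _ < K * ε' := by
            apply mul_lt_mul_of_pos_left _ hK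
            linarith
    nlinarith

end IsFrechetSupMeasure

end ImplicitExtremal

/-! ### Convergence in measure and distribution functions. -/

namespace MeasureTheory

variable {Ω F G : Type*} [MeasurableSpace Ω] {P : Measure Ω}
  [PseudoMetricSpace F]

theorem TendstoInMeasure.prodMk {G : Type*} [PseudoMetricSpace G] {X : ℕ → Ω → F} {Y : ℕ → Ω → G}
    {X' : Ω → F} {Y' : Ω → G} (hX : TendstoInMeasure P X atTop X')
    (hY : TendstoInMeasure P Y atTop Y') :
    TendstoInMeasure P (fun n ω => (X n ω, Y n ω)) atTop (fun ω => (X' ω, Y' ω)) := by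
  intro ε hε
  have h := (hX ε hε).add (hY ε hε)
  rw [add_zero] at h
  refine tendsto_of_tendsto_of_tendsto_of_le_of_le tendsto_const_nhds h (fun _ => zero_le)
    fun n => ?_
  refine (measure_mono fun ω (hω : ε ≤ _) => ?_).trans (measure_union_le _ _)
  rwa [Prod.edist_eq, le_max_iff] at hω

variable [IsProbabilityMeasure P]

theorem measureReal_dist_le_add (X Y Z : Ω → F) (ε : ℝ) :
    P.real {ω | ε ≤ dist (X ω) (Z ω)} ≤
      P.real {ω | ε / 2 ≤ dist (X ω) (Y ω)} + P.real {ω | ε / 2 ≤ dist (Y ω) (Z ω)} := by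
  refine (measureReal_mono fun ω (hω : ε ≤ _) => ?_).trans (measureReal_union_le _ _)
  by_contra hc
  simp only [Set.mem_union, Set.mem_ofPred_eq, not_or, not_le] at hc
  linarith [dist_triangle (X ω) (Y ω) (Z ω)]

theorem TendstoInMeasure.of_dist {X Y : ℕ → Ω → F} {Z : Ω → F}
    (hX : TendstoInMeasure P X atTop Z)
    (hXY : ∀ ε, 0 < ε → Tendsto (fun n => P.real {ω | ε ≤ dist (Y n ω) (X n ω)}) atTop (𝓝 0)) :
    TendstoInMeasure P Y atTop Z := by
  rw [tendstoInMeasure_iff_measureReal_dist] at hX ⊢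
  intro ε hε
  have h := (hXY _ (half_pos hε)).add (hX _ (half_pos hε))
  rw [add_zero] at h
  exact squeeze_zero (fun n => measureReal_nonneg)
    (fun n => measureReal_dist_le_add (Y n) (X n) Z ε) h

/-- Sequences that are Cauchy in measure converge in measure. -/
theorem exists_tendstoInMeasure_of_cauchy {F : Type*} [MetricSpace F] [CompleteSpace F]
    [Nonempty F] [MeasurableSpace F] [BorelSpace F] [SecondCountableTopology F]
    {X : ℕ → Ω → F} (hX : ∀ n, Measurable (X n))
    (h : ∀ ε > 0, ∀ η > 0, ∃ N, ∀ k ≥ N, ∀ n ≥ N, P.real {ω | ε ≤ dist (X k ω) (X n ω)} ≤ η) :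
    ∃ Z, Measurable Z ∧ TendstoInMeasure P X atTop Z := by
  have hhalf : ∀ k : ℕ, (0 : ℝ) < (1 / 2) ^ k := fun k => by positivity
  -- A subsequence with summable errors converges almost surely by Borel–Cantelli; the Cauchy
  -- property carries the limit over to the full sequence.
  obtain ⟨φ, hφ, hφP⟩ := extraction_forall_of_eventually
    (P := fun k N => ∀ n ≥ N, P.real {ω | (1 / 2 : ℝ) ^ k ≤ dist (X N ω) (X n ω)} ≤ (1 / 2) ^ k)
    (fun k => by
      obtain ⟨N, hN⟩ := h _ (hhalf k) _ (hhalf k)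
      filter_upwards [eventually_ge_atTop N] with K hK n hn
      exact hN K hK n (le_trans hK hn))
  have hBC : ∀ᵐ ω ∂P, ∀ᶠ k in atTop,
      ¬ ((1 / 2 : ℝ) ^ k ≤ dist (X (φ k) ω) (X (φ (k + 1)) ω)) := by
    have := measure_setOfPred_frequently_eq_zero (μ := P)
      (p := fun k ω => (1 / 2 : ℝ) ^ k ≤ dist (X (φ k) ω) (X (φ (k + 1)) ω)) (by
        have hle : ∀ k : ℕ, P {ω | (1 / 2 : ℝ) ^ k ≤ dist (X (φ k) ω) (X (φ (k + 1)) ω)} ≤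
            ENNReal.ofReal ((1 / 2 : ℝ) ^ k) := fun k => by
          rw [← ofReal_measureReal]
          exact ENNReal.ofReal_le_ofReal (hφP k _ (hφ (Nat.lt_succ_self k)).le)
        refine ne_top_of_le_ne_top ?_ (ENNReal.tsum_le_tsum hle)
        rw [← ENNReal.ofReal_tsum_of_nonneg (fun k => (hhalf k).le) summable_geometric_two]
        exact ENNReal.ofReal_ne_top)
    rw [ae_iff]
    simpa only [not_eventually, not_not] using this
  have hlim : ∀ᵐ ω ∂P, ∃ z, Tendsto (fun k => X (φ k) ω) atTop (𝓝 z) := by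
    filter_upwards [hBC] with ω hω
    refine cauchySeq_tendsto_of_complete (cauchySeq_of_summable_dist ?_)
    refine Summable.of_norm_bounded_eventually_nat summable_geometric_two ?_
    filter_upwards [hω] with k hk
    rw [Real.norm_eq_abs, abs_of_nonneg dist_nonneg]
    exact (not_le.1 hk).le
  obtain ⟨Z, hZ, hZlim⟩ := measurable_limit_of_tendsto_metrizable_ae
    (fun k => (hX (φ k)).aemeasurable) hlim
  refine ⟨Z, hZ, ?_⟩
  have hsub : TendstoInMeasure P (fun k => X (φ k)) atTop Z :=
    tendstoInMeasure_of_tendsto_ae (fun k => (hX _).aestronglyMeasurable) hZlim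
  refine TendstoInMeasure.of_dist hsub fun ε hε => ?_
  rw [Metric.tendsto_atTop]
  intro η hη
  obtain ⟨N, hN⟩ := h ε hε (η / 2) (half_pos hη)
  refine ⟨N, fun n hn => ?_⟩
  rw [Real.dist_eq, sub_zero, abs_of_nonneg measureReal_nonneg]
  exact (hN n hn (φ n) (hn.trans (hφ.id_le n))).trans_lt (half_lt_self hη)

/-- The continuous mapping theorem for convergence in measure. -/
theorem TendstoInMeasure.continuous_comp {G : Type*} [PseudoMetricSpace G]
    [MeasurableSpace F] [OpensMeasurableSpace F]
    [MeasurableSpace G] [BorelSpace G] [SecondCountableTopology G]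
    {X : ℕ → Ω → F} {X' : Ω → F} (hm : ∀ n, Measurable (X n))
    (hX : TendstoInMeasure P X atTop X') {φ : F → G} (hφ : Continuous φ) :
    TendstoInMeasure P (fun n ω => φ (X n ω)) atTop (fun ω => φ (X' ω)) := by
  have hφm : ∀ n, AEStronglyMeasurable (fun ω => φ (X n ω)) P := fun n =>
    (hφ.measurable.comp (hm n)).aestronglyMeasurable
  rw [exists_seq_tendstoInMeasure_atTop_iff hφm]
  intro ns hns
  obtain ⟨ks, hks, h⟩ := (TendstoInMeasure.comp hX hns.tendsto_atTop).exists_seq_tendsto_ae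
  refine ⟨ks, hks, ?_⟩
  filter_upwards [h] with ω hω
  exact (hφ.tendsto _).comp hω

theorem measureReal_le_add_dist (V W : Ω → ℝ) (x ε : ℝ) :
    P.real {ω | V ω ≤ x} ≤ P.real {ω | W ω ≤ x + ε} + P.real {ω | ε ≤ dist (V ω) (W ω)} := by
  refine (measureReal_mono fun ω (hω : V ω ≤ x) => ?_).trans (measureReal_union_le _ _)
  by_contra hc
  simp only [Set.mem_union, Set.mem_ofPred_eq, not_or, not_le, Real.dist_eq] at hc
  linarith [neg_abs_le (V ω - W ω)]

/-- Limits of distribution functions under convergence in measure. -/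
theorem TendstoInMeasure.measureReal_le_eq {W : ℕ → Ω → ℝ} {W' : Ω → ℝ}
    (hW : TendstoInMeasure P W atTop W') {F : ℝ → ℝ} {x : ℝ}
    (hF : ∀ᶠ y in 𝓝 x, Tendsto (fun n => P.real {ω | W n ω ≤ y}) atTop (𝓝 (F y)))
    (hc : ContinuousAt F x) : P.real {ω | W' ω ≤ x} = F x := by
  rw [tendstoInMeasure_iff_measureReal_dist] at hW
  have hp : Tendsto (fun ε : ℝ => x + ε) (𝓝[>] 0) (𝓝 x) := by
    have : Tendsto (fun ε : ℝ => x + ε) (𝓝 0) (𝓝 (x + 0)) := tendsto_const_nhds.add tendsto_id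
    rw [add_zero] at this
    exact this.mono_left nhdsWithin_le_nhds
  have hn : Tendsto (fun ε : ℝ => x - ε) (𝓝[>] 0) (𝓝 x) := by
    have : Tendsto (fun ε : ℝ => x - ε) (𝓝 0) (𝓝 (x - 0)) := tendsto_const_nhds.sub tendsto_id
    rw [sub_zero] at this
    exact this.mono_left nhdsWithin_le_nhds
  -- For small `ε > 0`, `P (W' ≤ x)` is squeezed between `F (x - ε)` and `F (x + ε)`.
  apply le_antisymm
  · refine ge_of_tendsto (hc.tendsto.comp hp) ?_
    filter_upwards [hp.eventually hF, self_mem_nhdsWithin] with ε h1 hε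
    have h2 := h1.add (hW ε hε)
    rw [add_zero] at h2
    refine ge_of_tendsto' h2 fun n => ?_
    have := measureReal_le_add_dist (P := P) W' (W n) x ε
    simpa only [dist_comm] using this
  · refine le_of_tendsto (hc.tendsto.comp hn) ?_
    filter_upwards [hn.eventually hF, self_mem_nhdsWithin] with ε h1 hε
    have h2 := (tendsto_const_nhds (x := P.real {ω | W' ω ≤ x})).add (hW ε hε)
    rw [add_zero] at h2
    refine le_of_tendsto_of_tendsto' h1 h2 fun n => ?_
    have := measureReal_le_add_dist (P := P) (W n) W' (x - ε) ε
    rwa [sub_add_cancel] at this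

theorem TendstoInMeasure.tendsto_measureReal_le {W : ℕ → Ω → ℝ} {W' : Ω → ℝ}
    (hW : TendstoInMeasure P W atTop W') {F : ℝ → ℝ} {x : ℝ}
    (hF : ∀ᶠ y in 𝓝 x, P.real {ω | W' ω ≤ y} = F y)
    (hc : ContinuousAt F x) : Tendsto (fun n => P.real {ω | W n ω ≤ x}) atTop (𝓝 (F x)) := by
  rw [tendstoInMeasure_iff_measureReal_dist] at hW
  rw [Metric.tendsto_atTop]
  intro η hη
  obtain ⟨δ, hδ, hball⟩ := Metric.eventually_nhds_iff.1
    (hF.and (hc.tendsto.eventually (Metric.ball_mem_nhds _ (half_pos hη))))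
  have h1 := @hball (x + δ / 2) (by rw [Real.dist_eq, add_sub_cancel_left, abs_of_pos] <;> linarith)
  have h2 := @hball (x - δ / 2) (by
    rw [Real.dist_eq, sub_sub_cancel_left, abs_neg, abs_of_pos] <;> linarith)
  obtain ⟨N, hN⟩ := Metric.tendsto_atTop.1 (hW _ (half_pos hδ)) _ (half_pos hη)
  refine ⟨N, fun n hn => ?_⟩
  have h3 := hN n hn
  rw [Real.dist_eq, sub_zero, abs_of_nonneg measureReal_nonneg] at h3
  have h4 := measureReal_le_add_dist (P := P) (W n) W' x (δ / 2)
  have h5 := measureReal_le_add_dist (P := P) W' (W n) (x - δ / 2) (δ / 2)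
  simp only [dist_comm (W' _), sub_add_cancel] at h5
  have h6 := h1.2
  have h7 := h2.2
  rw [Real.dist_eq, abs_lt] at h6 h7
  rw [h1.1] at h4
  rw [h2.1] at h5
  rw [Real.dist_eq, abs_lt]
  constructor <;> linarith

end MeasureTheory

/-! ### Comparison of `|a ^ α - b ^ α|` and `|a - b| ^ α`. -/

section RealPowers

/-- Dividing by `b` reduces the claim to `t = a / b`. Near `t = 1` continuity gives `ε`; for `|t -
1| ≥ δ`, both `t` and `1` are at most `1 + |t - 1| ≤ (1 + 1 / δ) |t - 1|`. -/
theorem exists_abs_rpow_sub_rpow_le {α ε : ℝ} (hα : 0 < α) (hε : 0 < ε) :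
    ∃ C ≥ 0, ∀ a b : ℝ, 0 ≤ a → 0 ≤ b → |a ^ α - b ^ α| ≤ ε * b ^ α + C * |a - b| ^ α := by
  have hc : ContinuousAt (fun t : ℝ => t ^ α) 1 :=
    Real.continuousAt_rpow_const _ _ (Or.inl one_ne_zero)
  obtain ⟨δ, hδ, h⟩ := Metric.continuousAt_iff.1 hc ε hε
  have key : ∀ t : ℝ, 0 ≤ t → |t ^ α - 1| ≤ ε + (1 + 1 / δ) ^ α * |t - 1| ^ α := by
    intro t ht
    have hpos : 0 ≤ (1 + 1 / δ) ^ α * |t - 1| ^ α := by positivity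
    rcases lt_or_ge |t - 1| δ with ht1 | ht1
    · have := h (x := t) (by rwa [Real.dist_eq])
      rw [Real.dist_eq, Real.one_rpow] at this
      linarith
    · have h1 : 1 + |t - 1| ≤ (1 + 1 / δ) * |t - 1| := by
        have : 1 ≤ 1 / δ * |t - 1| := by rw [one_div_mul_eq_div, le_div_iff₀ hδ]; linarith
        linarith
      have h2 : (1 + |t - 1|) ^ α ≤ (1 + 1 / δ) ^ α * |t - 1| ^ α := by
        rw [← Real.mul_rpow (by positivity) (by positivity)]
        exact Real.rpow_le_rpow (by positivity) h1 hα.le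
      have h3 : t ^ α ≤ (1 + |t - 1|) ^ α :=
        Real.rpow_le_rpow ht (by linarith [le_abs_self (t - 1)]) hα.le
      have h4 : 1 ≤ (1 + |t - 1|) ^ α :=
        Real.one_le_rpow (by linarith [abs_nonneg (t - 1)]) hα.le
      have h5 : 0 ≤ t ^ α := by positivity
      rw [abs_le]
      constructor <;> linarith
  refine ⟨(1 + 1 / δ) ^ α, by positivity, fun a b ha hb => ?_⟩
  rcases hb.eq_or_lt with rfl | hb'
  · rw [Real.zero_rpow hα.ne', sub_zero, sub_zero, mul_zero, zero_add, abs_of_nonneg ha,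
      abs_of_nonneg (by positivity)]
    refine le_mul_of_one_le_left (by positivity) (Real.one_le_rpow ?_ hα.le)
    have : 0 < 1 / δ := by positivity
    linarith
  · have hbα : 0 < b ^ α := by positivity
    have h1 := mul_le_mul_of_nonneg_left (key (a / b) (by positivity)) hbα.le
    have e1 : b ^ α * |(a / b) ^ α - 1| = |a ^ α - b ^ α| := by
      rw [Real.div_rpow ha hb, ← abs_of_pos hbα, ← abs_mul, abs_of_pos hbα]
      congr 1; field_simp
    have e2 : b ^ α * |a / b - 1| ^ α = |a - b| ^ α := by
      rw [← Real.mul_rpow hb (abs_nonneg _)]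
      congr 1
      rw [← abs_of_pos hb', ← abs_mul, abs_of_pos hb']
      congr 1; field_simp
    rw [e1] at h1
    rw [← e2]
    linarith

/-- This is the preceding inequality with exponent `α⁻¹` at `a ^ α`, `b ^ α`, raised to the power
`α`. The factors `2` come from bounding a sum by twice its larger term. -/
theorem exists_abs_sub_rpow_le {α ε : ℝ} (hα : 0 < α) (hε : 0 < ε) :
    ∃ C ≥ 0, ∀ a b : ℝ, 0 ≤ a → 0 ≤ b → |a - b| ^ α ≤ ε * b ^ α + C * |a ^ α - b ^ α| := by
  obtain ⟨C, hC, h⟩ := exists_abs_rpow_sub_rpow_le (α := α⁻¹) (ε := ε ^ α⁻¹ / 2)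
    (inv_pos.2 hα) (by positivity)
  refine ⟨(2 * C) ^ α, by positivity, fun a b ha hb => ?_⟩
  have h1 := h (a ^ α) (b ^ α) (by positivity) (by positivity)
  rw [Real.rpow_rpow_inv ha hα.ne', Real.rpow_rpow_inv hb hα.ne'] at h1
  set D := |a ^ α - b ^ α|
  have hD : 0 ≤ D := abs_nonneg _
  have p1 : 0 ≤ ε ^ α⁻¹ * b := by positivity
  have p2 : 0 ≤ 2 * C * D ^ α⁻¹ := by positivity
  have e1 : (ε ^ α⁻¹ * b) ^ α = ε * b ^ α := by
    rw [Real.mul_rpow (by positivity) hb, Real.rpow_inv_rpow hε.le hα.ne']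
  have e2 : (2 * C * D ^ α⁻¹) ^ α = (2 * C) ^ α * D := by
    rw [Real.mul_rpow (by positivity) (by positivity), Real.rpow_inv_rpow hD hα.ne']
  have q1 : 0 ≤ (ε ^ α⁻¹ * b) ^ α := by positivity
  have q2 : 0 ≤ (2 * C * D ^ α⁻¹) ^ α := by positivity
  rw [← e1, ← e2]
  rcases le_total (ε ^ α⁻¹ * b) (2 * C * D ^ α⁻¹) with hle | hle
  · have := Real.rpow_le_rpow (abs_nonneg _) (show |a - b| ≤ 2 * C * D ^ α⁻¹ by linarith) hα.le
    linarith
  · have := Real.rpow_le_rpow (abs_nonneg _) (show |a - b| ≤ ε ^ α⁻¹ * b by linarith) hα.le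
    linarith

/-- First `ε` makes the `w`-part small, then `C` is fixed and the `v`-part tends to `0`. In the
application `w = g ^ α`, so no bound uniform in `n` on the sequence is required. -/
theorem tendsto_lintegral_of_forall_le {E : Type*} [MeasurableSpace E] {m : Measure E}
    {u v : ℕ → E → ℝ} {w : E → ℝ} (hw : Measurable w) (hw0 : ∀ s, 0 ≤ w s)
    (hwfin : ∫⁻ s, ENNReal.ofReal (w s) ∂m ≠ ∞)
    (hv0 : ∀ n s, 0 ≤ v n s)
    (h : ∀ ε > 0, ∃ C ≥ 0, ∀ n s, u n s ≤ ε * w s + C * v n s)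
    (hlim : Tendsto (fun n => ∫⁻ s, ENNReal.ofReal (v n s) ∂m) atTop (𝓝 0)) :
    Tendsto (fun n => ∫⁻ s, ENNReal.ofReal (u n s) ∂m) atTop (𝓝 0) := by
  rw [ENNReal.tendsto_nhds_zero]
  intro η hη
  obtain ⟨ε, hε, hεη⟩ : ∃ ε > 0, ENNReal.ofReal ε * ∫⁻ s, ENNReal.ofReal (w s) ∂m ≤ η / 2 := by
    have h1 : Tendsto (fun ε : ℝ => ENNReal.ofReal ε * ∫⁻ s, ENNReal.ofReal (w s) ∂m) (𝓝[>] 0)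
        (𝓝 (ENNReal.ofReal 0 * ∫⁻ s, ENNReal.ofReal (w s) ∂m)) :=
      ENNReal.Tendsto.mul_const
        ((ENNReal.continuous_ofReal.tendsto 0).mono_left nhdsWithin_le_nhds) (Or.inr hwfin)
    rw [ENNReal.ofReal_zero, zero_mul] at h1
    have h2 := (h1.eventually (ge_mem_nhds (ENNReal.half_pos hη.ne'))).and self_mem_nhdsWithin
    obtain ⟨ε, h3, h4⟩ := h2.exists
    exact ⟨ε, h4, h3⟩
  obtain ⟨C, hC, hle⟩ := h ε hε
  have h2 : Tendsto (fun n => ENNReal.ofReal C * ∫⁻ s, ENNReal.ofReal (v n s) ∂m) atTop (𝓝 0) := by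
    have := ENNReal.Tendsto.const_mul (a := ENNReal.ofReal C) hlim (Or.inr ENNReal.ofReal_ne_top)
    rwa [mul_zero] at this
  filter_upwards [h2.eventually (ge_mem_nhds (ENNReal.half_pos hη.ne'))] with n hn
  calc ∫⁻ s, ENNReal.ofReal (u n s) ∂m
      ≤ ∫⁻ s, (ENNReal.ofReal ε * ENNReal.ofReal (w s) +
          ENNReal.ofReal C * ENNReal.ofReal (v n s)) ∂m := by
        refine lintegral_mono fun s => ?_
        rw [← ENNReal.ofReal_mul hε.le, ← ENNReal.ofReal_mul hC,
          ← ENNReal.ofReal_add (mul_nonneg hε.le (hw0 s)) (mul_nonneg hC (hv0 n s))]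
        exact ENNReal.ofReal_le_ofReal (hle n s)
    _ = ENNReal.ofReal ε * ∫⁻ s, ENNReal.ofReal (w s) ∂m +
          ENNReal.ofReal C * ∫⁻ s, ENNReal.ofReal (v n s) ∂m := by
        rw [lintegral_add_left (by fun_prop), lintegral_const_mul _ (by fun_prop),
          lintegral_const_mul' _ _ ENNReal.ofReal_ne_top]
    _ ≤ η / 2 + η / 2 := add_le_add hεη hn
    _ = η := ENNReal.add_halves η

end RealPowers

/-! ### Approximation by simple functions. -/

namespace ImplicitExtremal

variable {E : Type*} [MeasurableSpace E] {m : Measure E} {α : ℝ}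

theorem tendsto_lintegral_abs_rpow_sub_iff (hα : 0 < α) {g : E → ℝ} {gseq : ℕ → E → ℝ}
    (hg : g ∈ LpPlus α m) (hgs : ∀ n, gseq n ∈ LpPlus α m) :
    Tendsto (fun n => ∫⁻ s, ENNReal.ofReal |gseq n s ^ α - g s ^ α| ∂m) atTop (𝓝 0) ↔
      Tendsto (fun n => ∫⁻ s, ENNReal.ofReal (|gseq n s - g s| ^ α) ∂m) atTop (𝓝 0) := by
  have hgm := hg.1
  have h0 : ∀ s, 0 ≤ g s ^ α := fun s => Real.rpow_nonneg (hg.2.1 s) _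
  constructor
  · refine tendsto_lintegral_of_forall_le (hgm.pow_const α) h0 hg.2.2.ne
      (fun n s => abs_nonneg _) fun ε hε => ?_
    obtain ⟨C, hC, h⟩ := exists_abs_sub_rpow_le hα hε
    exact ⟨C, hC, fun n s => h _ _ ((hgs n).2.1 s) (hg.2.1 s)⟩
  · refine tendsto_lintegral_of_forall_le (hgm.pow_const α) h0 hg.2.2.ne
      (fun n s => by positivity) fun ε hε => ?_
    obtain ⟨C, hC, h⟩ := exists_abs_rpow_sub_rpow_le hα hε
    exact ⟨C, hC, fun n s => h _ _ ((hgs n).2.1 s) (hg.2.1 s)⟩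

/-- A nonnegative simple function with finite-measure support has a representation. -/
theorem exists_simpleRep (φ : SimpleFunc E ℝ) (h0 : ∀ s, 0 ≤ φ s)
    (hfin : ∀ v, v ≠ 0 → m (φ ⁻¹' {v}) < ∞) : ∃ r : SimpleRep m, r.toFun = φ := by
  classical
  let e := φ.range.equivFin
  -- Index `0` is a dummy term on `∅`, since a representation has at least one term. The level set
  -- of the value `0` is replaced by `∅` because it may have infinite measure.
  let c : Fin (φ.range.card + 1) → ℝ := Fin.cases 0 fun i => (e.symm i : ℝ)
  let A : Fin (φ.range.card + 1) → Set E :=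
    Fin.cases ∅ fun i => if (e.symm i : ℝ) = 0 then ∅ else φ ⁻¹' {(e.symm i : ℝ)}
  have hA : ∀ j s, s ∈ A j → φ s = c j ∧ j ≠ 0 := by
    intro j s hs
    induction j using Fin.cases with
    | zero => exact hs.elim
    | succ i =>
      simp only [A, Fin.cases_succ] at hs
      split_ifs at hs
      · exact hs.elim
      · exact ⟨hs, Fin.succ_ne_zero i⟩
  have hcinj : ∀ i j, i ≠ 0 → j ≠ 0 → c i = c j → i = j := by
    intro i j hi hj hij
    obtain ⟨i, rfl⟩ := Fin.exists_succ_eq.2 hi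
    obtain ⟨j, rfl⟩ := Fin.exists_succ_eq.2 hj
    simp only [c, Fin.cases_succ] at hij
    rw [e.symm.injective (Subtype.ext hij)]
  let r : SimpleRep m :=
    { k := φ.range.card
      coeff := c
      supp := A
      coeff_nonneg := by
        intro j
        induction j using Fin.cases with
        | zero => exact le_rfl
        | succ i =>
          obtain ⟨s, hs⟩ := SimpleFunc.mem_range.1 (e.symm i).2
          simp only [c, Fin.cases_succ]
          rw [← hs]; exact h0 s
      supp_mem := by
        intro j
        induction j using Fin.cases with
        | zero => exact ⟨MeasurableSet.empty, by simp [A]⟩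
        | succ i =>
          simp only [A, Fin.cases_succ]
          split_ifs with h
          · exact ⟨MeasurableSet.empty, by simp⟩
          · exact ⟨φ.measurableSet_fiber _, hfin _ h⟩
      disjoint := by
        intro i j hij
        refine Set.disjoint_left.2 fun s hi hj => hij ?_
        have h1 := hA i s hi
        have h2 := hA j s hj
        exact hcinj i j h1.2 h2.2 (h1.1.symm.trans h2.1) }
  refine ⟨r, funext fun s => ?_⟩
  by_cases hs : φ s = 0
  · by_cases h : ∃ j, s ∈ r.supp j
    · obtain ⟨j, hj⟩ := h
      rw [r.toFun_of_mem hj]; exact (hA j s hj).1.symm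
    · push Not at h
      rw [r.toFun_of_notMem h, hs]
  · have hj : s ∈ A (Fin.succ (e ⟨φ s, φ.mem_range_self s⟩)) := by
      simp only [A, Fin.cases_succ, Equiv.symm_apply_apply, if_neg hs]
      exact rfl
    exact (r.toFun_of_mem (j := Fin.succ (e ⟨φ s, φ.mem_range_self s⟩)) hj).trans
      (hA _ s hj).1.symm

/-- The standard simple approximations lie below `g`, so Markov's inequality for `g ^ α` makes their
nonzero level sets of finite measure. -/
theorem exists_increasesTo (hα : 0 < α) {g : E → ℝ} (hg : g ∈ LpPlus α m) :
    ∃ r : ℕ → SimpleRep m, IncreasesTo r g := by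
  have hgm : Measurable fun s => ENNReal.ofReal (g s) := hg.1.ennreal_ofReal
  let φ : ℕ → SimpleFunc E ℝ := fun n =>
    (SimpleFunc.eapprox (fun s => ENNReal.ofReal (g s)) n).map ENNReal.toReal
  have hφ : ∀ n s, φ n s = (SimpleFunc.eapprox (fun s => ENNReal.ofReal (g s)) n s).toReal :=
    fun n s => rfl
  have hle : ∀ n s, φ n s ≤ g s := fun n s => by
    have : SimpleFunc.eapprox (fun s => ENNReal.ofReal (g s)) n s ≤ ENNReal.ofReal (g s) := by
      rw [← SimpleFunc.iSup_eapprox_apply hgm s]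
      exact le_iSup (fun n => SimpleFunc.eapprox (fun s => ENNReal.ofReal (g s)) n s) n
    rw [hφ]
    exact ENNReal.toReal_le_of_le_ofReal (hg.2.1 s) this
  have hrep : ∀ n, ∃ r : SimpleRep m, r.toFun = φ n := by
    intro n
    refine exists_simpleRep (φ n) (fun s => ENNReal.toReal_nonneg) fun v hv => ?_
    by_cases hvpos : 0 < v
    · have hsub : φ n ⁻¹' {v} ⊆ {s | ENNReal.ofReal (v ^ α) ≤ ENNReal.ofReal (g s ^ α)} := by
        intro s hs
        refine ENNReal.ofReal_le_ofReal (Real.rpow_le_rpow hvpos.le ?_ hα.le)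
        rw [← show φ n s = v from hs]
        exact hle n s
      refine (measure_mono hsub).trans_lt ((meas_ge_le_lintegral_div
        (hg.1.pow_const α).ennreal_ofReal.aemeasurable
        (ENNReal.ofReal_pos.2 (by positivity)).ne' ENNReal.ofReal_ne_top).trans_lt ?_)
      exact ENNReal.div_lt_top hg.2.2.ne (ENNReal.ofReal_pos.2 (by positivity)).ne'
    · have : φ n ⁻¹' {v} = ∅ := by
        refine Set.eq_empty_of_forall_notMem fun s hs => hvpos ?_
        rw [← show φ n s = v from hs] at hv ⊢
        exact ENNReal.toReal_nonneg.lt_of_ne hv.symm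
      simp [this]
  choose r hr using hrep
  refine ⟨r, fun n s => ?_, fun s => ?_⟩
  · rw [hr, hr, hφ, hφ]
    exact ENNReal.toReal_mono (SimpleFunc.eapprox_lt_top _ _ _).ne
      (SimpleFunc.monotone_eapprox _ (Nat.le_succ n) s)
  · have := (ENNReal.tendsto_toReal ENNReal.ofReal_ne_top).comp (SimpleFunc.tendsto_eapprox hgm s)
    rw [ENNReal.toReal_ofReal (hg.2.1 s)] at this
    refine this.congr fun n => ?_
    rw [hr]; rfl

theorem IncreasesTo.le {r : ℕ → SimpleRep m} {g : E → ℝ} (h : IncreasesTo r g) (n : ℕ) (s : E) :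
    (r n).toFun s ≤ g s :=
  (monotone_nat_of_le_succ fun n => h.1 n s).ge_of_tendsto (h.2 s) n

theorem IncreasesTo.lintegral_le (hα : 0 < α) {r : ℕ → SimpleRep m} {g : E → ℝ}
    (hr : IncreasesTo r g) (n : ℕ) :
    ∫⁻ s, ENNReal.ofReal ((r n).toFun s ^ α) ∂m ≤ ∫⁻ s, ENNReal.ofReal (g s ^ α) ∂m :=
  lintegral_mono fun s => ENNReal.ofReal_le_ofReal
    (Real.rpow_le_rpow ((r n).toFun_nonneg s) (hr.le n s) hα.le)

theorem IncreasesTo.tendsto_lintegral (hα : 0 < α) {r : ℕ → SimpleRep m} {g : E → ℝ}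
    (h : IncreasesTo r g) (hg : g ∈ LpPlus α m) :
    Tendsto (fun n => ∫⁻ s, ENNReal.ofReal |(r n).toFun s ^ α - g s ^ α| ∂m) atTop (𝓝 0) := by
  have hgm := hg.1
  have hrm n := (r n).measurable_toFun
  have := tendsto_lintegral_of_dominated_convergence (μ := m) (f := fun _ => 0)
    (F := fun n s => ENNReal.ofReal |(r n).toFun s ^ α - g s ^ α|)
    (fun s => ENNReal.ofReal (g s ^ α)) (fun n => by fun_prop)
    (fun n => Eventually.of_forall fun s => by
      refine ENNReal.ofReal_le_ofReal ?_
      have h1 := Real.rpow_le_rpow ((r n).toFun_nonneg s) (h.le n s) hα.le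
      have h2 := Real.rpow_nonneg ((r n).toFun_nonneg s) α
      rw [abs_sub_comm, abs_of_nonneg] <;> linarith)
    hg.2.2.ne (Eventually.of_forall fun s => by
      have h1 := ((Real.continuousAt_rpow_const (g s) α (Or.inr hα.le)).tendsto.comp (h.2 s))
      have h2 := (h1.sub_const (g s ^ α)).abs
      rw [sub_self, abs_zero] at h2
      have h3 := (ENNReal.continuous_ofReal.tendsto 0).comp h2
      rwa [ENNReal.ofReal_zero] at h3)
  simpa using this

theorem IncreasesTo.tendsto_lintegral_max (hα : 0 < α) {r r' : ℕ → SimpleRep m} {g g' : E → ℝ}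
    (h : IncreasesTo r g) (hg : g ∈ LpPlus α m) (h' : IncreasesTo r' g') (hg' : g' ∈ LpPlus α m) :
    Tendsto (fun n => ∫⁻ s, ENNReal.ofReal (max ((r n).toFun s) ((r' n).toFun s) ^ α) ∂m) atTop
      (𝓝 (∫⁻ s, ENNReal.ofReal (max (g s) (g' s) ^ α) ∂m)) := by
  have hgm := hg.1
  have hgm' := hg'.1
  have hrm n := (r n).measurable_toFun
  have hrm' n := (r' n).measurable_toFun
  refine tendsto_lintegral_of_dominated_convergence
    (fun s => ENNReal.ofReal (g s ^ α) + ENNReal.ofReal (g' s ^ α)) (fun n => by fun_prop)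
    (fun n => Eventually.of_forall fun s => ?_) ?_ (Eventually.of_forall fun s => ?_)
  · have h1 := Real.rpow_le_rpow ((r n).toFun_nonneg s) (h.le n s) hα.le
    have h2 := Real.rpow_le_rpow ((r' n).toFun_nonneg s) (h'.le n s) hα.le
    rcases le_total ((r n).toFun s) ((r' n).toFun s) with hc | hc
    · simp only [max_eq_right hc]
      exact (ENNReal.ofReal_le_ofReal h2).trans le_add_self
    · simp only [max_eq_left hc]
      exact (ENNReal.ofReal_le_ofReal h1).trans le_self_add
  · rw [lintegral_add_left (by fun_prop)]
    exact ENNReal.add_ne_top.2 ⟨hg.2.2.ne, hg'.2.2.ne⟩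
  · exact (ENNReal.continuous_ofReal.tendsto _).comp
      ((Real.continuousAt_rpow_const _ α (Or.inr hα.le)).tendsto.comp ((h.2 s).max (h'.2 s)))

theorem lintegral_abs_sub_triangle {u v w : E → ℝ} (hu : Measurable u) (hv : Measurable v) :
    ∫⁻ s, ENNReal.ofReal |u s - w s| ∂m ≤
      ∫⁻ s, ENNReal.ofReal |u s - v s| ∂m + ∫⁻ s, ENNReal.ofReal |v s - w s| ∂m := by
  rw [← lintegral_add_left (by fun_prop)]
  refine lintegral_mono fun s => ?_
  rw [← ENNReal.ofReal_add (abs_nonneg _) (abs_nonneg _)]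
  exact ENNReal.ofReal_le_ofReal (abs_sub_le _ _ _)

/-! ### The extremal integral on `LpPlus α m`. -/

namespace IsFrechetSupMeasure

variable {Ω E : Type*} [MeasurableSpace Ω] [MeasurableSpace E]
    {P : Measure Ω} [IsProbabilityMeasure P] {m : Measure E}
    {d : ℕ} {f : EuclideanSpace ℝ (Fin d) → ℝ} {α : ℝ} {κ : Measure {x // f x = 1}}
    [IsProbabilityMeasure κ] {M : Set E → Ω → EuclideanSpace ℝ (Fin d)}

theorem exists_isExtremalIntegral (H : IsFrechetSupMeasure P m f α κ M) {g : E → ℝ}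
    (hg : g ∈ LpPlus α m) : ∃ X, IsExtremalIntegral P m f M g X := by
  obtain ⟨r, hr⟩ := exists_increasesTo H.pos hg
  set B := (∫⁻ s, ENNReal.ofReal (g s ^ α) ∂m).toReal
  have hB : ENNReal.ofReal B = ∫⁻ s, ENNReal.ofReal (g s ^ α) ∂m :=
    ENNReal.ofReal_toReal hg.2.2.ne
  have hmr : ∀ r : SimpleRep m, Measurable fun s => r.toFun s ^ α := fun r =>
    r.measurable_toFun.pow_const α
  have hmg : Measurable fun s => g s ^ α := hg.1.pow_const α
  -- Used with `r = r'` this is the Cauchy property; with different sequences it shows that the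
  -- limit does not depend on the choice.
  have close : ∀ r r' : ℕ → SimpleRep m, IncreasesTo r g → IncreasesTo r' g → ∀ ε > 0, ∀ η > 0,
      ∃ N, ∀ k ≥ N, ∀ n ≥ N,
        P.real {ω | ε ≤ dist ((r k).integral f M ω) ((r' n).integral f M ω)} ≤ η := by
    intro r r' hr hr' ε hε η hη
    obtain ⟨δ, hδ, h⟩ := H.exists_delta_integral (B := B) ENNReal.toReal_nonneg hε hη
    have hδ2 : (0 : ℝ≥0∞) < ENNReal.ofReal (δ / 2) := ENNReal.ofReal_pos.2 (half_pos hδ)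
    obtain ⟨N, hN⟩ := eventually_atTop.1 (((hr.tendsto_lintegral H.pos hg).eventually
      (ge_mem_nhds hδ2)).and ((hr'.tendsto_lintegral H.pos hg).eventually (ge_mem_nhds hδ2)))
    refine ⟨N, fun k hk n hn => h _ _ ?_ ?_⟩
    · rw [hB]; exact hr.lintegral_le H.pos k
    · refine (lintegral_abs_sub_triangle (hmr _) hmg).trans ?_
      have h2 := (hN n hn).2
      simp only [abs_sub_comm ((r' n).toFun _ ^ α)] at h2
      refine (add_le_add (hN k hk).1 h2).trans (le_of_eq ?_)
      rw [← ENNReal.ofReal_add (half_pos hδ).le (half_pos hδ).le, add_halves]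
  obtain ⟨X, hX, hlim⟩ := exists_tendstoInMeasure_of_cauchy
    (fun n => H.measurable_integral (r n)) (close r r hr hr)
  refine ⟨X, hX, ⟨r, hr⟩, fun r' hr' => TendstoInMeasure.of_dist hlim fun ε hε => ?_⟩
  rw [Metric.tendsto_atTop]
  intro η hη
  obtain ⟨N, hN⟩ := close r' r hr' hr ε hε (η / 2) (half_pos hη)
  refine ⟨N, fun n hn => ?_⟩
  rw [Real.dist_eq, sub_zero, abs_of_nonneg measureReal_nonneg]
  exact (hN n hn n hn).trans_lt (half_lt_self hη)

/-- Uniform continuity of the extremal integral on bounded subsets of `LpPlus α m`. -/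
theorem exists_delta_extremalIntegral (H : IsFrechetSupMeasure P m f α κ M) {B : ℝ} (hB : 0 ≤ B)
    {ε η : ℝ} (hε : 0 < ε) (hη : 0 < η) :
    ∃ δ > 0, ∀ g ∈ LpPlus α m, ∀ g' ∈ LpPlus α m, ∀ X X',
      IsExtremalIntegral P m f M g X → IsExtremalIntegral P m f M g' X' →
      ∫⁻ s, ENNReal.ofReal (g s ^ α) ∂m ≤ ENNReal.ofReal B →
      ∫⁻ s, ENNReal.ofReal |g s ^ α - g' s ^ α| ∂m ≤ ENNReal.ofReal δ →
      P.real {ω | ε ≤ dist (X ω) (X' ω)} ≤ η := by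
  obtain ⟨δ, hδ, h⟩ := H.exists_delta_integral hB (half_pos (half_pos hε)) hη
  -- The three thirds pay for the passages from `r n` to `g`, from `g` to `g'`, and from `g'` to `r'
  -- n`.
  refine ⟨δ / 3, by positivity, fun g hg g' hg' X X' hX hX' hgB hgg' => ?_⟩
  obtain ⟨r, hr⟩ := hX.2.1
  obtain ⟨r', hr'⟩ := hX'.2.1
  have hδ3 : (0 : ℝ≥0∞) < ENNReal.ofReal (δ / 3) := ENNReal.ofReal_pos.2 (by positivity)
  have hmr : ∀ r : SimpleRep m, Measurable fun s => r.toFun s ^ α := fun r =>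
    r.measurable_toFun.pow_const α
  have l1 := tendstoInMeasure_iff_measureReal_dist.1 (hX.2.2 r hr) _ (half_pos hε)
  have l2 := tendstoInMeasure_iff_measureReal_dist.1 (hX'.2.2 r' hr') _ (half_pos (half_pos hε))
  have l3 := (l1.add l2).add_const η
  rw [add_zero, zero_add] at l3
  refine ge_of_tendsto l3 ?_
  filter_upwards [(hr.tendsto_lintegral H.pos hg).eventually (ge_mem_nhds hδ3),
    (hr'.tendsto_lintegral H.pos hg').eventually (ge_mem_nhds hδ3)] with n h1 h2
  have h3 := h (r n) (r' n) ((hr.lintegral_le H.pos n).trans hgB) (by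
    simp only [abs_sub_comm ((r' n).toFun _ ^ α)] at h2
    have t1 := lintegral_abs_sub_triangle (m := m) (w := fun s => (r' n).toFun s ^ α)
      (hmr (r n)) (hg.1.pow_const α)
    have t2 := lintegral_abs_sub_triangle (m := m) (w := fun s => (r' n).toFun s ^ α)
      (hg.1.pow_const α) (hg'.1.pow_const α)
    refine t1.trans ((add_le_add h1 (t2.trans (add_le_add hgg' h2))).trans (le_of_eq ?_))
    rw [← ENNReal.ofReal_add (by positivity) (by positivity),
      ← ENNReal.ofReal_add (by positivity) (by positivity)]
    congr 1; ring)
  have h4 := measureReal_dist_le_add (P := P) X ((r n).integral f M) X' ε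
  have h5 := measureReal_dist_le_add (P := P) ((r n).integral f M) ((r' n).integral f M) X' (ε / 2)
  simp only [dist_comm (X _) ((r n).integral f M _)] at h4
  linarith

/-- The joint distribution function of the losses of two extremal integrals. -/
theorem measureReal_extremalIntegral_le (H : IsFrechetSupMeasure P m f α κ M) {g g' : E → ℝ}
    (hg : g ∈ LpPlus α m) (hg' : g' ∈ LpPlus α m) {X X' : Ω → EuclideanSpace ℝ (Fin d)}
    (hX : IsExtremalIntegral P m f M g X) (hX' : IsExtremalIntegral P m f M g' X')
    {x : ℝ} (hx : 0 < x) :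
    P.real {ω | max (f (X ω)) (f (X' ω)) ≤ x} =
      Real.exp (-((∫⁻ s, ENNReal.ofReal (max (g s) (g' s) ^ α) ∂m).toReal * x ^ (-α))) := by
  obtain ⟨r, hr⟩ := hX.2.1
  obtain ⟨r', hr'⟩ := hX'.2.1
  have hcont : Continuous fun p : EuclideanSpace ℝ (Fin d) × EuclideanSpace ℝ (Fin d) =>
      max (f p.1) (f p.2) :=
    (H.loss.continuous.comp continuous_fst).max (H.loss.continuous.comp continuous_snd)
  have hW := ((hX.2.2 r hr).prodMk (hX'.2.2 r' hr')).continuous_comp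
    (fun n => (H.measurable_integral (r n)).prodMk (H.measurable_integral (r' n))) hcont
  have hfin : ∫⁻ s, ENNReal.ofReal (max (g s) (g' s) ^ α) ∂m ≠ ∞ := by
    have hgm := hg.1
    have hle : ∫⁻ s, ENNReal.ofReal (max (g s) (g' s) ^ α) ∂m ≤
        ∫⁻ s, (ENNReal.ofReal (g s ^ α) + ENNReal.ofReal (g' s ^ α)) ∂m := by
      refine lintegral_mono fun s => ?_
      rcases le_total (g s) (g' s) with hc | hc
      · simp only [max_eq_right hc]; exact le_add_self
      · simp only [max_eq_left hc]; exact le_self_add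
    rw [lintegral_add_left (by fun_prop)] at hle
    exact ne_top_of_le_ne_top (ENNReal.add_ne_top.2 ⟨hg.2.2.ne, hg'.2.2.ne⟩) hle
  have hΛ := (ENNReal.tendsto_toReal hfin).comp
    (hr.tendsto_lintegral_max H.pos hg hr' hg')
  refine hW.measureReal_le_eq
    (F := fun x => Real.exp (-((∫⁻ s, ENNReal.ofReal (max (g s) (g' s) ^ α) ∂m).toReal *
      x ^ (-α)))) ?_ ?_
  · filter_upwards [lt_mem_nhds hx] with y hy
    simp only [H.measureReal_integral_le _ _ hy]
    exact (Real.continuous_exp.tendsto _).comp (hΛ.mul_const _).neg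
  · exact ((continuousAt_const.mul (Real.continuousAt_rpow_const _ _ (Or.inl hx.ne'))).neg).rexp

/-- The maximum of the two losses converges in probability, so its distribution function converges
at `1`, where it equals `exp` of minus the scale; the logarithm recovers the scale. -/
theorem tendsto_lintegral_max_of_tendstoInMeasure (H : IsFrechetSupMeasure P m f α κ M)
    {g g' : E → ℝ} {u u' : ℕ → E → ℝ} (hg : g ∈ LpPlus α m) (hg' : g' ∈ LpPlus α m)
    (hu : ∀ n, u n ∈ LpPlus α m) (hu' : ∀ n, u' n ∈ LpPlus α m)
    {X X' : Ω → EuclideanSpace ℝ (Fin d)} {Y Y' : ℕ → Ω → EuclideanSpace ℝ (Fin d)}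
    (hX : IsExtremalIntegral P m f M g X) (hX' : IsExtremalIntegral P m f M g' X')
    (hY : ∀ n, IsExtremalIntegral P m f M (u n) (Y n))
    (hY' : ∀ n, IsExtremalIntegral P m f M (u' n) (Y' n))
    (hlim : TendstoInMeasure P Y atTop X) (hlim' : TendstoInMeasure P Y' atTop X') :
    Tendsto (fun n => (∫⁻ s, ENNReal.ofReal (max (u n s) (u' n s) ^ α) ∂m).toReal) atTop
      (𝓝 (∫⁻ s, ENNReal.ofReal (max (g s) (g' s) ^ α) ∂m).toReal) := by
  have hcont : Continuous fun p : EuclideanSpace ℝ (Fin d) × EuclideanSpace ℝ (Fin d) =>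
      max (f p.1) (f p.2) :=
    (H.loss.continuous.comp continuous_fst).max (H.loss.continuous.comp continuous_snd)
  have hW := (hlim.prodMk hlim').continuous_comp
    (fun n => (hY n).1.prodMk (hY' n).1) hcont
  have h := hW.tendsto_measureReal_le (x := 1)
    (F := fun x => Real.exp (-((∫⁻ s, ENNReal.ofReal (max (g s) (g' s) ^ α) ∂m).toReal *
      x ^ (-α))))
    (by filter_upwards [lt_mem_nhds one_pos] with y hy using
          H.measureReal_extremalIntegral_le hg hg' hX hX' hy)
    ((continuousAt_const.mul (Real.continuousAt_rpow_const _ _ (Or.inl one_ne_zero))).neg).rexp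
  simp only [H.measureReal_extremalIntegral_le (hu _) (hu' _) (hY _) (hY' _) one_pos,
    Real.one_rpow, mul_one] at h
  have h2 := ((Real.continuousAt_log (Real.exp_pos _).ne').tendsto.comp h).neg
  simpa [Function.comp_def] using h2

theorem tendstoInMeasure_iff (H : IsFrechetSupMeasure P m f α κ M)
    {g : E → ℝ} {u : ℕ → E → ℝ} (hg : g ∈ LpPlus α m) (hu : ∀ n, u n ∈ LpPlus α m)
    {X : Ω → EuclideanSpace ℝ (Fin d)} {Y : ℕ → Ω → EuclideanSpace ℝ (Fin d)}
    (hX : IsExtremalIntegral P m f M g X) (hY : ∀ n, IsExtremalIntegral P m f M (u n) (Y n)) :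
    TendstoInMeasure P Y atTop X ↔
      Tendsto (fun n => ∫⁻ s, ENNReal.ofReal |u n s ^ α - g s ^ α| ∂m) atTop (𝓝 0) := by
  have hgm := hg.1
  have hum n := (hu n).1
  have hnn : ∀ {g : E → ℝ}, g ∈ LpPlus α m → ∀ s, 0 ≤ g s ^ α := fun hg s =>
    Real.rpow_nonneg (hg.2.1 s) _
  constructor
  · intro hlim
    have hconst : TendstoInMeasure P (fun _ : ℕ => X) atTop X := by
      intro ε hε
      simp [hε.not_ge]
    -- Pairing the sequence with itself gives convergence of `∫ u n ^ α`; pairing it with the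
    -- constant sequence `X` gives `∫ max (u n, g) ^ α → ∫ g ^ α`.
    have h1 := H.tendsto_lintegral_max_of_tendstoInMeasure hg hg hu hu hX hX hY hY hlim hlim
    have h2 := H.tendsto_lintegral_max_of_tendstoInMeasure hg hg hu (fun _ => hg) hX hX hY
      (fun _ => hX) hlim hconst
    simp only [max_self] at h1 h2
    set Λ := ∫⁻ s, ENNReal.ofReal (g s ^ α) ∂m
    have key : ∀ n, ∫⁻ s, ENNReal.ofReal |u n s ^ α - g s ^ α| ∂m +
        (∫⁻ s, ENNReal.ofReal (u n s ^ α) ∂m + Λ) =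
        2 * ∫⁻ s, ENNReal.ofReal (max (u n s) (g s) ^ α) ∂m := by
      intro n
      rw [← lintegral_add_left (by fun_prop), ← lintegral_add_left (by fun_prop),
        ← lintegral_const_mul _ (by fun_prop)]
      refine lintegral_congr fun s => ?_
      have a1 := hnn (hu n) s
      have a2 := hnn hg s
      have a3 : 0 ≤ max (u n s) (g s) ^ α :=
        Real.rpow_nonneg (((hu n).2.1 s).trans (le_max_left _ _)) _
      rw [← ENNReal.ofReal_add a1 a2, ← ENNReal.ofReal_add (abs_nonneg _) (add_nonneg a1 a2),
        ← ENNReal.ofReal_ofNat 2, ← ENNReal.ofReal_mul zero_le_two]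
      congr 1
      rcases le_total (u n s) (g s) with hc | hc
      · have := Real.rpow_le_rpow ((hu n).2.1 s) hc H.pos.le
        rw [max_eq_right hc, abs_of_nonpos (by linarith)]; ring
      · have := Real.rpow_le_rpow (hg.2.1 s) hc H.pos.le
        rw [max_eq_left hc, abs_of_nonneg (by linarith)]; ring
    have hDfin : ∀ n, ∫⁻ s, ENNReal.ofReal |u n s ^ α - g s ^ α| ∂m ≠ ∞ := by
      intro n
      refine ne_top_of_le_ne_top (ENNReal.add_ne_top.2 ⟨(hu n).2.2.ne, hg.2.2.ne⟩)
        (b := ∫⁻ s, ENNReal.ofReal (u n s ^ α) ∂m + Λ) ?_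
      rw [← lintegral_add_left (by fun_prop)]
      refine lintegral_mono fun s => ?_
      have a1 := hnn (hu n) s
      have a2 := hnn hg s
      rw [← ENNReal.ofReal_add a1 a2]
      refine ENNReal.ofReal_le_ofReal ?_
      rw [abs_le]; constructor <;> linarith
    rw [← ENNReal.tendsto_toReal_zero_iff hDfin]
    have key2 : ∀ n, (∫⁻ s, ENNReal.ofReal |u n s ^ α - g s ^ α| ∂m).toReal =
        2 * (∫⁻ s, ENNReal.ofReal (max (u n s) (g s) ^ α) ∂m).toReal -
          ((∫⁻ s, ENNReal.ofReal (u n s ^ α) ∂m).toReal + Λ.toReal) := by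
      intro n
      have := congrArg ENNReal.toReal (key n)
      rw [ENNReal.toReal_add (hDfin n) (ENNReal.add_ne_top.2 ⟨(hu n).2.2.ne, hg.2.2.ne⟩),
        ENNReal.toReal_add (hu n).2.2.ne hg.2.2.ne, ENNReal.toReal_mul,
        ENNReal.toReal_ofNat] at this
      linarith
    simp only [key2]
    have h3 := (h2.const_mul 2).sub (h1.add_const Λ.toReal)
    rwa [show 2 * Λ.toReal - (Λ.toReal + Λ.toReal) = 0 by ring] at h3
  · intro hlim
    rw [tendstoInMeasure_iff_measureReal_dist]
    intro ε hε
    rw [Metric.tendsto_atTop]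
    intro η hη
    obtain ⟨δ, hδ, h⟩ := H.exists_delta_extremalIntegral
      (B := (∫⁻ s, ENNReal.ofReal (g s ^ α) ∂m).toReal) ENNReal.toReal_nonneg hε (half_pos hη)
    obtain ⟨N, hN⟩ := eventually_atTop.1
      (hlim.eventually (ge_mem_nhds (ENNReal.ofReal_pos.2 hδ)))
    refine ⟨N, fun n hn => ?_⟩
    rw [Real.dist_eq, sub_zero, abs_of_nonneg measureReal_nonneg]
    have h1 := hN n hn
    simp only [abs_sub_comm (u n _ ^ α)] at h1
    -- Only the first function must have mass at most `B`, so the fixed `g` takes that place.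
    have h2 := h g hg (u n) (hu n) X (Y n) hX (hY n) (ENNReal.ofReal_toReal hg.2.2.ne).ge h1
    simp only [dist_comm (X _)] at h2
    linarith

theorem isExtremalIntegral_extremalIntegral (H : IsFrechetSupMeasure P m f α κ M) {g : E → ℝ}
    (hg : g ∈ LpPlus α m) : IsExtremalIntegral P m f M g (extremalIntegral P m f M g) := by
  have h := H.exists_isExtremalIntegral hg
  unfold extremalIntegral
  rw [dif_pos h]
  exact h.choose_spec

end IsFrechetSupMeasure

end ImplicitExtremal

theorem mainTheorem3 {Ω E : Type*} [MeasurableSpace Ω] [MeasurableSpace E]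
    (P : Measure Ω) [IsProbabilityMeasure P] (m : Measure E) [SigmaFinite m]
    {d : ℕ} (f : EuclideanSpace ℝ (Fin d) → ℝ) (hf : IsLossFunction f)
    (α : ℝ) (hα : 0 < α) (κ : Measure {x // f x = 1}) [IsProbabilityMeasure κ]
    (M : Set E → Ω → EuclideanSpace ℝ (Fin d)) (hM : IsImplicitSupMeasure P m f M)
    (hlaw : ∀ A ∈ finiteSets m, HasImplicitFrechetLaw P f α κ ((m A).toReal ^ (1 / α)) (M A)) :
    (∀ h ∈ LpPlus α m, IsExtremalIntegral P m f M h (extremalIntegral P m f M h)) ∧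
    ∀ (g : E → ℝ) (gseq : ℕ → E → ℝ), g ∈ LpPlus α m → (∀ n, gseq n ∈ LpPlus α m) →
      ((TendstoInMeasure P (fun n => extremalIntegral P m f M (gseq n)) atTop
            (extremalIntegral P m f M g) ↔
          Tendsto (fun n => ∫⁻ s, ENNReal.ofReal |gseq n s ^ α - g s ^ α| ∂m) atTop (𝓝 0)) ∧
        (Tendsto (fun n => ∫⁻ s, ENNReal.ofReal |gseq n s ^ α - g s ^ α| ∂m) atTop (𝓝 0) ↔
          Tendsto (fun n => ∫⁻ s, ENNReal.ofReal (|gseq n s - g s| ^ α) ∂m) atTop (𝓝 0))) := by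
  have H : IsFrechetSupMeasure P m f α κ M := ⟨hf, hα, hM, hlaw⟩
  refine ⟨fun h hh => H.isExtremalIntegral_extremalIntegral hh, fun g gseq hg hgs => ⟨?_, ?_⟩⟩
  · exact H.tendstoInMeasure_iff hg hgs (H.isExtremalIntegral_extremalIntegral hg)
      fun n => H.isExtremalIntegral_extremalIntegral (hgs n)
  · exact tendsto_lintegral_abs_rpow_sub_iff hα hg hgs
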